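/- **Weakness of the sudden singularity.** Let $t_0<t_S$, let $a:(t_0,t_S)\to(0,\infty)$ be a $C^2$ scale factor, and consider the flat Friedmann spacetime $(t_0,t_S)\times\mathbb R^3$ with metric $ds^2=-dt^2+a(t)^2\sum_{\alpha=1}^3(dx^\alpha)^2$. Let $H=\dot a/a$ and suppose that $t_S$ is a sudden singularity: as $t\uparrow t_S$, $a\to a_S\in(0,\infty)$, $H\to H_S\in\mathbb R$ and $\dot H\to-\infty$. A future-directed causal geodesic $\gamma:(\lambda_0,\lambda_S)\to(t_0,t_S)\times\mathbb R^3$, affinely parametrized, *runs into the singularity* if $\lambda_S<\infty$ and $t(\lambda)\to t_S$ as $\lambda\uparrow\lambda_S$. Put $k=3$ if $\gamma$ is timelike and $k=2$ if $\gamma$ is null; transverse deviation vectors along $\gamma$ are Jacobi fields orthogonal to the tangent $u$ of $\gamma$, and the volume of $k$ of them is $V=\sqrt{\det(g(\eta_i,\eta_j))}$. * $\gamma$ terminates in a *Tipler-strong* singularity if for all $k$ linearly independent, vorticity-free ($g(\eta_i,D\eta_j)=g(D\eta_i,\eta_j)$), transverse deviation vectors, $V\to0$ as $\lambda\uparrow\lambda_S$.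 * $\gamma$ terminates in a *Królak-strong* singularity if for each point $p$ of $\gamma$ the expansion $\dot V/V$ along $\gamma$ of every congruence of causal geodesics of the same type emanating from $p$ and containing $\gamma$ (described by $k$ transverse deviation vectors that vanish at $p$, with $\det(g(D\eta_i,D\eta_j))\neq0$ at $p$) becomes negative somewhere on $\gamma$ after $p$. Then: 1. The comoving curves $t\mapsto(t,\xi)$, $\xi\in\mathbb R^3$, are timelike geodesics with affine parameter $t$ that run into the singularity. Along each of them, for all $i,j$ and every $\tau\in(t_0,t_S)$, both integrals $$\int_\tau^{\lambda}\bigl|R^i{}_{ajb}u^au^b\bigr|\,d\lambda',\qquad \int_\tau^{\lambda}d\lambda'\int_\tau^{\lambda'}d\lambda''\,\bigl|R^i{}_{ajb}u^au^b\bigr|$$ (of Królak and of Tipler) converge to finite limits as $\lambda\uparrow t_S$. 2. The singularity is weak in both senses: no future-directed causal geodesic that runs into it terminates there in a Tipler-strong or in a Królak-strong singularity. 3. Geodesics can be continued through the singularity. The scale factor has a positive continuation beyond $t_S$ that is $C^1$ across $t_S$ and $C^2$ for $t>t_S$. Moreover, for every positive continuous continuation $b$ of $a$ to some $(t_0,t_1)$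 with $t_1>t_S$, every future-directed causal geodesic $\gamma$ that runs into the singularity extends to a $C^1$ curve $(t(\lambda),x^\alpha(\lambda))$ on some $(\lambda_0,\lambda_1)$, $\lambda_1>\lambda_S$, with $t(\lambda)\in(t_0,t_1)$, $dt/d\lambda>0$ and $t(\lambda_S)=t_S$, which solves the integrated geodesic equations $$\frac{dx^\alpha}{d\lambda}=\frac{P^\alpha}{b^2},\qquad \Bigl(\frac{dt}{d\lambda}\Bigr)^2=\varepsilon+\frac{P^2}{b^2}$$ for some constants $\varepsilon,P^\alpha$ with $P^2=\sum_\alpha(P^\alpha)^2$; and if $b$ is differentiable on $(t_0,t_1)$, this curve satisfies the (second-order) geodesic equations of the continued metric on all of $(\lambda_0,\lambda_1)$. -/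

import Mathlib

open Set Filter Topology MeasureTheory
open scoped Matrix

noncomputable section

/-! ### Lorentzian geometry in a global chart `Fin 4 → ℝ`, with `x 0 = t` the time coordinate -/

/-- A point, or a tangent vector, in a coordinate chart of a four-dimensional spacetime. -/
abbrev Pt := Fin 4 → ℝ

/-- A metric tensor in the chart: the matrix of components `g_{μν}(x)`. -/
abbrev MetricField := Pt → Matrix (Fin 4) (Fin 4) ℝ

/-- The partial derivative `∂_μ f` at `x`. -/
def partialD (μ : Fin 4) (f : Pt → ℝ) (x : Pt) : ℝ :=
  deriv (fun s : ℝ => f (Function.update x μ s)) (x μ)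

/-- The Christoffel symbols
`Γ^μ_{νρ} = (1/2) g^{μσ} (∂_ν g_{σρ} + ∂_ρ g_{σν} - ∂_σ g_{νρ})`. -/
def christoffel (g : MetricField) (x : Pt) (μ ν ρ : Fin 4) : ℝ :=
  (1 / 2) * ∑ σ, (g x)⁻¹ μ σ *
    (partialD ν (fun y => g y σ ρ) x + partialD ρ (fun y => g y σ ν) x
      - partialD σ (fun y => g y ν ρ) x)

/-- The Riemann tensor
`R^ρ_{σμν} = ∂_μ Γ^ρ_{νσ} - ∂_ν Γ^ρ_{μσ} + Γ^ρ_{μκ} Γ^κ_{νσ} - Γ^ρ_{νκ} Γ^κ_{μσ}`. -/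
def riemann (g : MetricField) (x : Pt) (ρ σ μ ν : Fin 4) : ℝ :=
  partialD μ (fun y => christoffel g y ρ ν σ) x
    - partialD ν (fun y => christoffel g y ρ μ σ) x
    + ∑ κ, (christoffel g x ρ μ κ * christoffel g x κ ν σ
        - christoffel g x ρ ν κ * christoffel g x κ μ σ)

/-- The scalar product `g_{μν} v^μ w^ν` at `x`. -/
def metricProd (g : MetricField) (x v w : Pt) : ℝ := ∑ μ, ∑ ν, g x μ ν * v μ * w ν

/-- `γ` is an affinely parametrized geodesic on the open set `s` of parameters:
`d²x^μ/dl² + Γ^μ_{νρ} (dx^ν/dl) (dx^ρ/dl) = 0`. -/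
def IsGeodesicOn (g : MetricField) (γ : ℝ → Pt) (s : Set ℝ) : Prop :=
  ∀ l ∈ s, DifferentiableAt ℝ γ l ∧
    HasDerivAt (deriv γ)
      (fun μ => - ∑ ν, ∑ ρ, christoffel g (γ l) μ ν ρ * deriv γ l ν * deriv γ l ρ) l

/-- The covariant derivative `Dη/dl` of a vector field `η` along the curve `γ`. -/
def covD (g : MetricField) (γ η : ℝ → Pt) (l : ℝ) : Pt := fun μ =>
  deriv η l μ + ∑ ν, ∑ ρ, christoffel g (γ l) μ ν ρ * deriv γ l ν * η l ρ

/-- The tidal matrix `R^i_{ajb} u^a u^b` along `γ`, with `u` the tangent vector of `γ`. -/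
def tidal (g : MetricField) (γ : ℝ → Pt) (i j : Fin 4) (l : ℝ) : ℝ :=
  ∑ α, ∑ β, riemann g (γ l) i α j β * deriv γ l α * deriv γ l β

/-- `η` is a geodesic deviation vector (Jacobi field) along `γ` on `s`:
`D²η^i/dl² = - R^i_{ajb} u^a η^j u^b`. -/
def IsJacobiOn (g : MetricField) (γ η : ℝ → Pt) (s : Set ℝ) : Prop :=
  ∀ l ∈ s, DifferentiableAt ℝ η l ∧ DifferentiableAt ℝ (covD g γ η) l ∧
    ∀ i, covD g γ (covD g γ η) l i = - ∑ j, tidal g γ i j l * η l j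

/-- The Gram matrix of `k` vectors at `x`. -/
def gram (g : MetricField) {k : ℕ} (x : Pt) (v : Fin k → Pt) : Matrix (Fin k) (Fin k) ℝ :=
  Matrix.of fun i j => metricProd g x (v i) (v j)

/-- The `k`-volume spanned along `γ` by the vector fields `η 0, …, η (k-1)`. -/
def volElem (g : MetricField) (γ : ℝ → Pt) {k : ℕ} (η : Fin k → ℝ → Pt) (l : ℝ) : ℝ :=
  Real.sqrt (gram g (γ l) (fun i => η i l)).det

/-- The expansion `V⁻¹ dV/dl` on `γ` of the congruence of geodesics around `γ` whose
deviation vectors are the `η i`. -/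
def expansion (g : MetricField) (γ : ℝ → Pt) {k : ℕ} (η : Fin k → ℝ → Pt) (l : ℝ) : ℝ :=
  deriv (volElem g γ η) l / volElem g γ η l

/-- A family of `k` geodesic deviation vectors along `γ` that are orthogonal to `γ`. -/
def IsTransverseJacobiFamily (g : MetricField) (γ : ℝ → Pt) {k : ℕ} (η : Fin k → ℝ → Pt)
    (s : Set ℝ) : Prop :=
  ∀ i, IsJacobiOn g γ (η i) s ∧ ∀ l ∈ s, metricProd g (γ l) (η i l) (deriv γ l) = 0

/-- The deviation vectors are vorticity-free: `⟨η_i, Dη_j⟩ = ⟨Dη_i, η_j⟩`. -/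
def IsVorticityFree (g : MetricField) (γ : ℝ → Pt) {k : ℕ} (η : Fin k → ℝ → Pt)
    (s : Set ℝ) : Prop :=
  ∀ i j, ∀ l ∈ s, metricProd g (γ l) (η i l) (covD g γ (η j) l)
    = metricProd g (γ l) (covD g γ (η i) l) (η j l)

/-- `γ` is timelike on `s`. -/
def IsTimelikeOn (g : MetricField) (γ : ℝ → Pt) (s : Set ℝ) : Prop :=
  ∀ l ∈ s, metricProd g (γ l) (deriv γ l) (deriv γ l) < 0

/-- `γ` is null (lightlike) on `s`. -/
def IsNullOn (g : MetricField) (γ : ℝ → Pt) (s : Set ℝ) : Prop :=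
  ∀ l ∈ s, deriv γ l ≠ 0 ∧ metricProd g (γ l) (deriv γ l) (deriv γ l) = 0

/-- Every volume element defined by `k` linearly independent, vorticity-free, transverse
geodesic deviation vectors along `γ : (l₀, lS) → spacetime` vanishes in the limit `l → lS`. -/
def AllVolumesVanish (k : ℕ) (g : MetricField) (γ : ℝ → Pt) (l₀ lS : ℝ) : Prop :=
  ∀ η : Fin k → ℝ → Pt, IsTransverseJacobiFamily g γ η (Ioo l₀ lS) →
    IsVorticityFree g γ η (Ioo l₀ lS) →
    LinearIndependent ℝ (fun i => (Ioo l₀ lS).domRestrict (η i)) →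
    Tendsto (volElem g γ η) (𝓝[<] lS) (𝓝 0)

/-- Strong curvature singularity in the sense of Tipler at the end `lS` of the causal geodesic
`γ : (l₀, lS) → spacetime`. The space of directions transverse to a timelike geodesic has
dimension three, that of directions transverse to a null geodesic (modulo its tangent) has
dimension two. -/
def TiplerStrong (g : MetricField) (γ : ℝ → Pt) (l₀ lS : ℝ) : Prop :=
  (IsTimelikeOn g γ (Ioo l₀ lS) → AllVolumesVanish 3 g γ l₀ lS) ∧
  (IsNullOn g γ (Ioo l₀ lS) → AllVolumesVanish 2 g γ l₀ lS)

/-- For each point `γ p`, the expansion of every congruence of geodesics emanating from `γ p` and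
containing `γ` (all deviation vectors vanish at `p`, and their derivatives there span the
transverse directions) becomes negative somewhere on `γ` after `p`. -/
def AllExpansionsBecomeNegative (k : ℕ) (g : MetricField) (γ : ℝ → Pt) (l₀ lS : ℝ) : Prop :=
  ∀ p ∈ Ioo l₀ lS, ∀ η : Fin k → ℝ → Pt, IsTransverseJacobiFamily g γ η (Ioo l₀ lS) →
    (∀ i, η i p = 0) → (gram g (γ p) (fun i => covD g γ (η i) p)).det ≠ 0 →
    ∃ l ∈ Ioo p lS, expansion g γ η l < 0

/-- Strong curvature singularity in the sense of Królak at the end `lS` of the causal geodesic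
`γ : (l₀, lS) → spacetime`. -/
def KrolakStrong (g : MetricField) (γ : ℝ → Pt) (l₀ lS : ℝ) : Prop :=
  (IsTimelikeOn g γ (Ioo l₀ lS) → AllExpansionsBecomeNegative 3 g γ l₀ lS) ∧
  (IsNullOn g γ (Ioo l₀ lS) → AllExpansionsBecomeNegative 2 g γ l₀ lS)

/-- The single integral `∫_{τ}^{l} |R^i_{ajb} u^a u^b| dl'` along `γ`. -/
def krolakIntegral (g : MetricField) (γ : ℝ → Pt) (i j : Fin 4) (τ l : ℝ) : ℝ :=
  ∫ l' in τ..l, |tidal g γ i j l'|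

/-- The double integral `∫_{τ}^{l} dl' ∫_{τ}^{l'} dl'' |R^i_{ajb} u^a u^b|` along `γ`. -/
def tiplerIntegral (g : MetricField) (γ : ℝ → Pt) (i j : Fin 4) (τ l : ℝ) : ℝ :=
  ∫ l' in τ..l, krolakIntegral g γ i j τ l'

/-! ### Flat Friedmann spacetimes and sudden singularities -/

/-- The flat Friedmann metric `-dt² + a(t)² (dx₁² + dx₂² + dx₃²)`. -/
def friedmannMetric (a : ℝ → ℝ) : MetricField := fun x =>
  Matrix.diagonal ![-1, a (x 0) ^ 2, a (x 0) ^ 2, a (x 0) ^ 2]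

/-- The Hubble parameter `H = ȧ / a`. -/
def hubble (a : ℝ → ℝ) (t : ℝ) : ℝ := deriv a t / a t

/-- The flat Friedmann universe with scale factor `a` on `(t₀, tS)` ends at `tS` in a sudden
singularity: `a → aS ∈ (0, ∞)`, `H → HS ∈ ℝ` and `Ḣ → -∞`. -/
structure IsSuddenSingularity (a : ℝ → ℝ) (t₀ tS aS HS : ℝ) : Prop where
  lt : t₀ < tS
  contDiffOn : ContDiffOn ℝ 2 a (Ioo t₀ tS)
  pos : ∀ t ∈ Ioo t₀ tS, 0 < a t
  aS_pos : 0 < aS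
  tendsto_scale : Tendsto a (𝓝[<] tS) (𝓝 aS)
  tendsto_hubble : Tendsto (hubble a) (𝓝[<] tS) (𝓝 HS)
  tendsto_deriv_hubble : Tendsto (deriv (hubble a)) (𝓝[<] tS) atBot

/-- `γ : (l₀, lS) → (t₀, tS) × ℝ³` is a future-directed causal geodesic of the flat Friedmann
spacetime with scale factor `a` that runs into `t = tS` at the finite affine parameter `lS`. -/
structure IsCausalGeodesicInto (a : ℝ → ℝ) (t₀ tS : ℝ) (γ : ℝ → Pt) (l₀ lS : ℝ) : Prop where
  lt : l₀ < lS
  mem : ∀ l ∈ Ioo l₀ lS, γ l 0 ∈ Ioo t₀ tS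
  geodesic : IsGeodesicOn (friedmannMetric a) γ (Ioo l₀ lS)
  causal : ∀ l ∈ Ioo l₀ lS, metricProd (friedmannMetric a) (γ l) (deriv γ l) (deriv γ l) ≤ 0
  future : ∀ l ∈ Ioo l₀ lS, 0 < deriv γ l 0
  tendsto : Tendsto (fun l => γ l 0) (𝓝[<] lS) (𝓝 tS)

/-- The comoving curve through the point `ξ` of space, with `u = ∂/∂t` and parameter `t`. -/
def comoving (ξ : Fin 3 → ℝ) : ℝ → Pt := fun t => Fin.cons t ξ

/-- `b` is a continuous positive scale factor on `(t₀, t₁)`, with `t₁ > tS`, that continues the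
scale factor `a` on `(t₀, tS)`. -/
structure IsContinuation (a b : ℝ → ℝ) (t₀ tS t₁ : ℝ) : Prop where
  lt : tS < t₁
  eqOn : EqOn b a (Ioo t₀ tS)
  pos : ∀ t ∈ Ioo t₀ t₁, 0 < b t
  continuousOn : ContinuousOn b (Ioo t₀ t₁)

/-- The integrated geodesic equations `dx^α/dl = P^α / a²`, `(dt/dl)² = ε + P² / a²`. -/
def SatisfiesIntegratedGeodesicEq (a : ℝ → ℝ) (c : ℝ → Pt) (ε : ℝ) (P : Fin 3 → ℝ)
    (s : Set ℝ) : Prop :=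
  ∀ l ∈ s, DifferentiableAt ℝ c l ∧
    (∀ α : Fin 3, deriv c l α.succ = P α / a (c l 0) ^ 2) ∧
    deriv c l 0 ^ 2 = ε + (∑ α, P α ^ 2) / a (c l 0) ^ 2

end

/-!
Along a geodesic of the flat Friedmann metric the momenta `P^α = a² dx^α/dl` and the norm `-ε` of
the tangent `u` are conserved, so that `(dt/dl)² = ε + P²/a²`. Weakness and continuation both rest
on these first integrals (`exists_firstIntegrals`), because they involve `a` but not its
derivatives.

*Convergence of the curvature integrals.* For a comoving observer the only nonzero components of
the tidal matrix are `-(Ḣ + H²)`. Near the singularity `H` is decreasing with a finite limit, so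
`Ḣ` is integrable although it is unbounded (`IsSuddenSingularity.integrableOn_deriv_hubble`).

*Weakness.* Transverse Jacobi fields are known explicitly. In an orthonormal frame `e` of space with
`P = p e₂` the Killing fields `e₀`, `e₁` are Jacobi fields orthogonal to `u`, and so is the
combination `p u + ε e₂`. Their squared norms are `κ M` with `κ = 1, 1, ε` and
`M = a², a², a² (u⁰)²`. If `W` is one of them, `f W` is a Jacobi field whenever `f' M` is constant
(reduction of order,
`IsAlignedGeodesic.isJacobiOn_smul_frame`). The last field is used only in the timelike case, as it
has norm zero for `ε = 0`. With `f = 1` the volume has a positive limit, since the `W` stay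
orthogonal with lengths bounded away from zero; this refutes Tipler strength. With
`f = ∫_q 1 / M` the fields vanish at `q`, and after `q` the derivative of `f² κ M` has the sign of
`1 + f κ a ȧ u⁰`; as `a ȧ u⁰` is bounded and `f` is small on `(q, lS)` for `q` close to
`lS`, the expansion is nonnegative all the way to the singularity, which refutes Królak strength.

*Continuation.* `dl/dt = (ε + P²/b²)^(-1/2)` is a continuous positive function of `t` for every
continuous positive `b`. Its primitive is strictly increasing and `C¹` across `tS`, and the inverse
of the primitive gives `t(l)` beyond the singularity; `x^α(l)` follows by integrating `P^α/b²`.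
Differentiating the integrated equations gives back the geodesic equation, in which only the first
derivative of `b` occurs.
-/

/-! ### Connection and curvature of the flat Friedmann metric -/

/-- The Christoffel symbols of a flat Friedmann metric in closed form, with
`A = a ȧ = Γ^0_{αα}` and `B = ȧ / a = Γ^α_{0α} = Γ^α_{α0}`, all others being zero. -/
noncomputable def friedmannGamma (A B : ℝ) (μ ν ρ : Fin 4) : ℝ :=
  if μ = 0 then (if ν = ρ ∧ ν ≠ 0 then A else 0)
  else (if (ν = 0 ∧ ρ = μ) ∨ (ρ = 0 ∧ ν = μ) then B else 0)

lemma partialD_friedmannMetric {a : ℝ → ℝ} {x : Pt} (ha : DifferentiableAt ℝ a (x 0))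
    (ν σ ρ : Fin 4) :
    partialD ν (fun y => friedmannMetric a y σ ρ) x
      = if ν = 0 ∧ σ = ρ ∧ σ ≠ 0 then 2 * (a (x 0) * deriv a (x 0)) else 0 := by
  have h2 : deriv (fun s => a s ^ 2) (x 0) = 2 * (a (x 0) * deriv a (x 0)) := by
    rw [(ha.hasDerivAt.fun_pow 2).deriv]; simp; ring
  unfold partialD friedmannMetric
  by_cases hν : ν = 0
  · subst hν
    by_cases h : σ = ρ
    · subst h
      fin_cases σ <;> simp [h2]
    · simp [h]
  · simp [hν, Function.update_of_ne (Ne.symm hν)]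

lemma christoffel_friedmannMetric {a : ℝ → ℝ} {x : Pt} (ha : DifferentiableAt ℝ a (x 0))
    (h0 : a (x 0) ≠ 0) (μ ν ρ : Fin 4) :
    christoffel (friedmannMetric a) x μ ν ρ
      = friedmannGamma (a (x 0) * deriv a (x 0)) (deriv a (x 0) / a (x 0)) μ ν ρ := by
  have hinv : (friedmannMetric a x)⁻¹
      = Matrix.diagonal ![-1, (a (x 0) ^ 2)⁻¹, (a (x 0) ^ 2)⁻¹, (a (x 0) ^ 2)⁻¹] := by
    apply Matrix.inv_eq_left_inv
    rw [friedmannMetric, Matrix.diagonal_mul_diagonal, ← Matrix.diagonal_one]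
    congr 1
    ext i
    fin_cases i <;> simp [h0]
  simp only [christoffel, hinv, partialD_friedmannMetric ha]
  rw [Finset.sum_eq_single μ (fun σ _ h => by rw [Matrix.diagonal_apply_ne _ h.symm, zero_mul])
    (by simp), Matrix.diagonal_apply_eq]
  fin_cases μ <;> fin_cases ν <;> fin_cases ρ <;>
    simp [friedmannGamma] <;> field_simp

lemma metricProd_friedmannMetric (a : ℝ → ℝ) (x v w : Pt) :
    metricProd (friedmannMetric a) x v w
      = -(v 0 * w 0) + a (x 0) ^ 2 * ∑ α : Fin 3, v α.succ * w α.succ := by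
  simp [metricProd, friedmannMetric, Matrix.diagonal_apply, Fin.sum_univ_succ]
  ring

lemma sum_friedmannGamma (A B : ℝ) (v w : Pt) (μ : Fin 4) :
    ∑ ν, ∑ ρ, friedmannGamma A B μ ν ρ * v ν * w ρ
      = (Fin.cons (A * ∑ α : Fin 3, v α.succ * w α.succ)
          (fun α => B * (v 0 * w α.succ + v α.succ * w 0)) : Pt) μ := by
  refine Fin.cases ?_ (fun α => ?_) μ
  · simp [friedmannGamma, Fin.sum_univ_succ]; ring
  · rw [Fin.cons_succ]
    fin_cases α <;> simp [friedmannGamma, Fin.sum_univ_succ] <;> ring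

/-- The Christoffel symbols depend on `t` alone. Here `A'` and `B'` are the derivatives of `a ȧ` and
`ȧ / a`. -/
lemma partialD_christoffel {a : ℝ → ℝ} {x : Pt} {A' B' : ℝ}
    (ha : ∀ᶠ t in 𝓝 (x 0), DifferentiableAt ℝ a t ∧ a t ≠ 0)
    (hA : HasDerivAt (fun t => a t * deriv a t) A' (x 0))
    (hB : HasDerivAt (fun t => deriv a t / a t) B' (x 0)) (κ μ ν ρ : Fin 4) :
    partialD κ (fun y => christoffel (friedmannMetric a) y μ ν ρ) x
      = if κ = 0 then friedmannGamma A' B' μ ν ρ else 0 := by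
  unfold partialD
  split_ifs with h
  · subst h
    have h1 : (fun s => christoffel (friedmannMetric a) (Function.update x 0 s) μ ν ρ)
        =ᶠ[𝓝 (x 0)] fun s => friedmannGamma (a s * deriv a s) (deriv a s / a s) μ ν ρ := by
      filter_upwards [ha] with s hs
      rw [christoffel_friedmannMetric (by simpa using hs.1) (by simpa using hs.2)]
      simp
    rw [h1.deriv_eq]
    unfold friedmannGamma
    split_ifs <;> simp [hA.deriv, hB.deriv]
  · have h1 : (fun s => christoffel (friedmannMetric a) (Function.update x κ s) μ ν ρ)
        = fun s => friedmannGamma (a (x 0) * deriv a (x 0)) (deriv a (x 0) / a (x 0)) μ ν ρ := by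
      funext s
      have h0 : Function.update x κ s 0 = x 0 := Function.update_of_ne (Ne.symm h) _ _
      rw [christoffel_friedmannMetric (by simpa [h0] using ha.self_of_nhds.1)
        (by simpa [h0] using ha.self_of_nhds.2), h0]
    rw [h1]; simp

/-- The Jacobi operator `η ↦ R(·, u, η, u)` of the Friedmann metric in closed form. -/
lemma sum_tidal_friedmannMetric {a : ℝ → ℝ} {γ η : ℝ → Pt} {l A' B' : ℝ}
    (ha : ∀ᶠ t in 𝓝 (γ l 0), DifferentiableAt ℝ a t ∧ a t ≠ 0)
    (hA : HasDerivAt (fun t => a t * deriv a t) A' (γ l 0))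
    (hB : HasDerivAt (fun t => deriv a t / a t) B' (γ l 0)) (i : Fin 4) :
    ∑ j, tidal (friedmannMetric a) γ i j l * η l j
      = (Fin.cons ((A' - deriv a (γ l 0) ^ 2) *
          (η l 0 * ∑ α : Fin 3, deriv γ l α.succ * deriv γ l α.succ
            - deriv γ l 0 * ∑ α : Fin 3, deriv γ l α.succ * η l α.succ))
          (fun α => (B' + (deriv a (γ l 0) / a (γ l 0)) ^ 2) *
            (deriv γ l 0 * (η l 0 * deriv γ l α.succ - deriv γ l 0 * η l α.succ))
            + deriv a (γ l 0) ^ 2 *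
            (η l α.succ * (∑ α : Fin 3, deriv γ l α.succ * deriv γ l α.succ)
              - deriv γ l α.succ * ∑ α : Fin 3, deriv γ l α.succ * η l α.succ)) : Pt) i := by
  have hd := ha.self_of_nhds.1
  have h0 := ha.self_of_nhds.2
  have hAB : (a (γ l 0) * deriv a (γ l 0)) * (deriv a (γ l 0) / a (γ l 0))
      = deriv a (γ l 0) ^ 2 := by field_simp
  simp only [tidal, riemann, partialD_christoffel ha hA hB, christoffel_friedmannMetric hd h0]
  generalize a (γ l 0) * deriv a (γ l 0) = A at *
  generalize deriv a (γ l 0) / a (γ l 0) = B at *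
  rw [← hAB]
  generalize deriv γ l = u
  generalize η l = v
  refine Fin.cases ?_ (fun α => ?_) i
  · simp [friedmannGamma, Fin.sum_univ_succ]
    ring
  · rw [Fin.cons_succ]
    fin_cases α <;>
    · simp [friedmannGamma, Fin.sum_univ_succ]
      ring

lemma ContDiffAt.hasDerivAt_deriv_of_two {a : ℝ → ℝ} {t : ℝ} (h : ContDiffAt ℝ 2 a t) :
    HasDerivAt a (deriv a t) t ∧ HasDerivAt (deriv a) (deriv (deriv a) t) t := by
  refine ⟨(h.differentiableAt (by norm_num)).hasDerivAt, ?_⟩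
  have h1 : ContDiffAt ℝ 1 (deriv a) t := h.derivWithin (by norm_num)
  exact (h1.differentiableAt (by norm_num)).hasDerivAt

/-- The Jacobi operator of the Friedmann metric in terms of `ȧ` and `ä`. -/
lemma sum_tidal_of_contDiffAt {a : ℝ → ℝ} {γ : ℝ → Pt} {l : ℝ}
    (ha : ContDiffAt ℝ 2 a (γ l 0)) (h0 : 0 < a (γ l 0)) (η : ℝ → Pt) (i : Fin 4) :
    ∑ j, tidal (friedmannMetric a) γ i j l * η l j
      = (Fin.cons (a (γ l 0) * deriv (deriv a) (γ l 0) *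
          (η l 0 * ∑ α : Fin 3, deriv γ l α.succ * deriv γ l α.succ
            - deriv γ l 0 * ∑ α : Fin 3, deriv γ l α.succ * η l α.succ))
          (fun α => deriv (deriv a) (γ l 0) / a (γ l 0) *
            (deriv γ l 0 * (η l 0 * deriv γ l α.succ - deriv γ l 0 * η l α.succ))
            + deriv a (γ l 0) ^ 2 *
            (η l α.succ * (∑ α : Fin 3, deriv γ l α.succ * deriv γ l α.succ)
              - deriv γ l α.succ * ∑ α : Fin 3, deriv γ l α.succ * η l α.succ)) : Pt) i := by
  obtain ⟨h1, h2⟩ := ha.hasDerivAt_deriv_of_two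
  have hev : ∀ᶠ t in 𝓝 (γ l 0), DifferentiableAt ℝ a t ∧ a t ≠ 0 := by
    have e1 : ∀ᶠ t in 𝓝 (γ l 0), ContDiffAt ℝ 2 a t := ha.eventually (by simp)
    filter_upwards [e1, h1.continuousAt.eventually_ne h0.ne'] with t ht ht'
    exact ⟨ht.differentiableAt (by norm_num), ht'⟩
  rw [sum_tidal_friedmannMetric hev (h1.mul h2) (h2.div h1 h0.ne')]
  have e1 : deriv a (γ l 0) * deriv a (γ l 0) + a (γ l 0) * deriv (deriv a) (γ l 0)
      - deriv a (γ l 0) ^ 2 = a (γ l 0) * deriv (deriv a) (γ l 0) := by ring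
  have e2 : (deriv (deriv a) (γ l 0) * a (γ l 0) - deriv a (γ l 0) * deriv a (γ l 0))
      / a (γ l 0) ^ 2 + (deriv a (γ l 0) / a (γ l 0)) ^ 2
      = deriv (deriv a) (γ l 0) / a (γ l 0) := by
    field_simp; ring
  rw [e1, e2]

/-! ### Geodesics and their first integrals -/

lemma isGeodesicOn_friedmannMetric_iff {a : ℝ → ℝ} {γ : ℝ → Pt} {s : Set ℝ}
    (ha : ∀ l ∈ s, DifferentiableAt ℝ a (γ l 0) ∧ 0 < a (γ l 0)) :
    IsGeodesicOn (friedmannMetric a) γ s ↔ ∀ l ∈ s, DifferentiableAt ℝ γ l ∧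
      HasDerivAt (fun l => deriv γ l 0) (-(a (γ l 0) * deriv a (γ l 0) *
        ∑ α : Fin 3, deriv γ l α.succ * deriv γ l α.succ)) l ∧
      ∀ α : Fin 3, HasDerivAt (fun l => deriv γ l α.succ)
        (-(2 * (deriv a (γ l 0) / a (γ l 0)) * deriv γ l 0 * deriv γ l α.succ)) l := by
  refine forall₂_congr fun l hl => and_congr_right fun _ => ?_
  obtain ⟨hd, h0⟩ := ha l hl
  simp only [christoffel_friedmannMetric hd h0.ne', sum_friedmannGamma]
  rw [hasDerivAt_pi, Fin.forall_fin_succ]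
  simp only [Fin.cons_zero, Fin.cons_succ]
  refine and_congr Iff.rfl (forall_congr' fun α => ?_)
  rw [show ∀ B u v : ℝ, -(2 * B * u * v) = -(B * (u * v + v * u)) by intros; ring]

/-- The first integrals of the geodesic equation: the momenta `P^α = a² dx^α/dl` belonging to the
translations of space, and the norm `-ε` of the tangent. -/
lemma exists_firstIntegrals {a : ℝ → ℝ} {γ : ℝ → Pt} {s : Set ℝ} (hs : IsOpen s)
    (hc : IsPreconnected s) (ha : ∀ l ∈ s, DifferentiableAt ℝ a (γ l 0) ∧ 0 < a (γ l 0))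
    (hg : IsGeodesicOn (friedmannMetric a) γ s) :
    ∃ (ε : ℝ) (P : Fin 3 → ℝ), ∀ l ∈ s, (∀ α, deriv γ l α.succ = P α / a (γ l 0) ^ 2) ∧
      deriv γ l 0 ^ 2 = ε + (∑ α, P α ^ 2) / a (γ l 0) ^ 2 := by
  rw [isGeodesicOn_friedmannMetric_iff ha] at hg
  have hA : ∀ l ∈ s, HasDerivAt (fun l => a (γ l 0))
      (deriv a (γ l 0) * deriv γ l 0) l := fun l hl =>
    (ha l hl).1.hasDerivAt.comp l (hasDerivAt_pi.1 (hg l hl).1.hasDerivAt 0)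
  have hmom : ∀ α : Fin 3, ∃ p, ∀ l ∈ s, a (γ l 0) ^ 2 * deriv γ l α.succ = p := by
    intro α
    have hd : ∀ l ∈ s, HasDerivAt (fun l => a (γ l 0) ^ 2 * deriv γ l α.succ) 0 l := by
      intro l hl
      have h0 := (ha l hl).2.ne'
      refine (((hA l hl).fun_pow 2).mul ((hg l hl).2.2 α)).congr_deriv ?_
      field_simp
      ring
    exact hs.exists_is_const_of_deriv_eq_zero hc
      (fun l hl => (hd l hl).differentiableAt.differentiableWithinAt) (fun l hl => (hd l hl).deriv)
  have hnorm : ∃ ε, ∀ l ∈ s, deriv γ l 0 ^ 2 - a (γ l 0) ^ 2 *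
      ∑ α : Fin 3, deriv γ l α.succ * deriv γ l α.succ = ε := by
    have hd : ∀ l ∈ s, HasDerivAt (fun l => deriv γ l 0 ^ 2 - a (γ l 0) ^ 2 *
        ∑ α : Fin 3, deriv γ l α.succ * deriv γ l α.succ) 0 l := by
      intro l hl
      have h0 := (ha l hl).2.ne'
      have hsum : HasDerivAt (fun l => ∑ α : Fin 3, deriv γ l α.succ * deriv γ l α.succ)
          (-(4 * (deriv a (γ l 0) / a (γ l 0)) * deriv γ l 0 *
            ∑ α : Fin 3, deriv γ l α.succ * deriv γ l α.succ)) l := by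
        refine (HasDerivAt.fun_sum fun α _ =>
          ((hg l hl).2.2 α).mul ((hg l hl).2.2 α)).congr_deriv ?_
        rw [Finset.mul_sum, ← Finset.sum_neg_distrib]
        exact Finset.sum_congr rfl fun α _ => by ring
      refine (((hg l hl).2.1.fun_pow 2).sub (((hA l hl).fun_pow 2).mul hsum)).congr_deriv ?_
      field_simp
      ring
    exact hs.exists_is_const_of_deriv_eq_zero hc
      (fun l hl => (hd l hl).differentiableAt.differentiableWithinAt) (fun l hl => (hd l hl).deriv)
  choose P hP using hmom
  obtain ⟨ε, hε⟩ := hnorm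
  refine ⟨ε, P, fun l hl => ?_⟩
  have h0 := (ha l hl).2.ne'
  have h1 : ∀ α, deriv γ l α.succ = P α / a (γ l 0) ^ 2 := fun α => by
    rw [← hP α l hl]; field_simp
  refine ⟨h1, ?_⟩
  rw [← hε l hl, Finset.mul_sum, Finset.sum_div, sub_add, ← Finset.sum_sub_distrib,
    Finset.sum_eq_zero, sub_zero]
  intro α _
  rw [h1 α]
  field_simp
  simp

/-! ### Explicit transverse Jacobi fields -/

lemma covD_friedmannMetric {a : ℝ → ℝ} {γ : ℝ → Pt} {l : ℝ} (hd : DifferentiableAt ℝ a (γ l 0))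
    (h0 : a (γ l 0) ≠ 0) (η : ℝ → Pt) (μ : Fin 4) :
    covD (friedmannMetric a) γ η l μ = deriv η l μ
      + (Fin.cons (a (γ l 0) * deriv a (γ l 0) * ∑ α : Fin 3, deriv γ l α.succ * η l α.succ)
          (fun α => deriv a (γ l 0) / a (γ l 0) *
            (deriv γ l 0 * η l α.succ + deriv γ l α.succ * η l 0)) : Pt) μ := by
  simp only [covD, christoffel_friedmannMetric hd h0, sum_friedmannGamma]

lemma hasDerivAt_cons {ξ : ℝ → Pt} {l d₀ : ℝ} {d : Fin 3 → ℝ}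
    (h0 : HasDerivAt (fun l => ξ l 0) d₀ l)
    (h1 : ∀ α : Fin 3, HasDerivAt (fun l => ξ l α.succ) (d α) l) :
    HasDerivAt ξ (Fin.cons d₀ d : Pt) l :=
  hasDerivAt_pi.2 (Fin.cases h0 h1)

/-- A criterion for Jacobi fields of the Friedmann metric in components, where `ζ` stands for the
covariant derivative of `η`. -/
lemma isJacobiOn_friedmannMetric {a : ℝ → ℝ} {γ η ζ : ℝ → Pt} {s : Set ℝ} (hs : IsOpen s)
    (ha : ∀ l ∈ s, ContDiffAt ℝ 2 a (γ l 0) ∧ 0 < a (γ l 0))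
    (hη0 : ∀ l ∈ s, HasDerivAt (fun l => η l 0) (ζ l 0 - a (γ l 0) * deriv a (γ l 0) *
      ∑ α : Fin 3, deriv γ l α.succ * η l α.succ) l)
    (hη1 : ∀ l ∈ s, ∀ α : Fin 3, HasDerivAt (fun l => η l α.succ) (ζ l α.succ
      - deriv a (γ l 0) / a (γ l 0) *
        (deriv γ l 0 * η l α.succ + deriv γ l α.succ * η l 0)) l)
    (hζ0 : ∀ l ∈ s, HasDerivAt (fun l => ζ l 0)
      (-(a (γ l 0) * deriv (deriv a) (γ l 0) *
          (η l 0 * ∑ α : Fin 3, deriv γ l α.succ * deriv γ l α.succ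
            - deriv γ l 0 * ∑ α : Fin 3, deriv γ l α.succ * η l α.succ))
        - a (γ l 0) * deriv a (γ l 0) * ∑ α : Fin 3, deriv γ l α.succ * ζ l α.succ) l)
    (hζ1 : ∀ l ∈ s, ∀ α : Fin 3, HasDerivAt (fun l => ζ l α.succ)
      (-(deriv (deriv a) (γ l 0) / a (γ l 0) *
            (deriv γ l 0 * (η l 0 * deriv γ l α.succ - deriv γ l 0 * η l α.succ))
            + deriv a (γ l 0) ^ 2 *
            (η l α.succ * (∑ α : Fin 3, deriv γ l α.succ * deriv γ l α.succ)
              - deriv γ l α.succ * ∑ α : Fin 3, deriv γ l α.succ * η l α.succ))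
        - deriv a (γ l 0) / a (γ l 0) *
        (deriv γ l 0 * ζ l α.succ + deriv γ l α.succ * ζ l 0)) l) :
    IsJacobiOn (friedmannMetric a) γ η s ∧
      ∀ l ∈ s, covD (friedmannMetric a) γ η l = ζ l := by
  have hη : ∀ l ∈ s, HasDerivAt η _ l :=
    fun l hl => hasDerivAt_cons (hη0 l hl) (hη1 l hl)
  have hζ : ∀ l ∈ s, HasDerivAt ζ _ l :=
    fun l hl => hasDerivAt_cons (hζ0 l hl) (hζ1 l hl)
  have hcov : ∀ l ∈ s, covD (friedmannMetric a) γ η l = ζ l := by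
    intro l hl
    have hd := (ha l hl).1.differentiableAt (by norm_num)
    funext μ
    rw [covD_friedmannMetric hd (ha l hl).2.ne', (hη l hl).deriv]
    refine Fin.cases ?_ (fun α => ?_) μ <;> simp
  have hev : ∀ l ∈ s, covD (friedmannMetric a) γ η =ᶠ[𝓝 l] ζ := fun l hl => by
    filter_upwards [hs.mem_nhds hl] with m hm using hcov m hm
  refine ⟨fun l hl => ⟨(hη l hl).differentiableAt, ?_, fun i => ?_⟩, hcov⟩
  · exact (hev l hl).differentiableAt_iff.2 (hζ l hl).differentiableAt
  · have hd := (ha l hl).1.differentiableAt (by norm_num)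
    rw [sum_tidal_of_contDiffAt (ha l hl).1 (ha l hl).2,
      covD_friedmannMetric hd (ha l hl).2.ne', (hev l hl).deriv_eq, (hζ l hl).deriv, hcov l hl]
    refine Fin.cases ?_ (fun α => ?_) i <;> simp

/-- A future-directed geodesic of the Friedmann spacetime whose momentum is `p` times the last vector of the
orthonormal frame `e` of space, with `-ε` the norm of the tangent, on the open set `s` of
parameters, where the scale factor is positive and `C²`. -/
structure IsAlignedGeodesic (a : ℝ → ℝ) (γ : ℝ → Pt) (s : Set ℝ) (ε p : ℝ)
    (e : Fin 3 → Fin 3 → ℝ) : Prop where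
  isOpen : IsOpen s
  regular : ∀ l ∈ s, ContDiffAt ℝ 2 a (γ l 0) ∧ 0 < a (γ l 0)
  geodesic : IsGeodesicOn (friedmannMetric a) γ s
  orthonormal : ∀ i j, ∑ α, e i α * e j α = if i = j then 1 else 0
  momentum : ∀ l ∈ s, ∀ α : Fin 3, deriv γ l α.succ = p / a (γ l 0) ^ 2 * e 2 α
  energy : ∀ l ∈ s, deriv γ l 0 ^ 2 = ε + p ^ 2 / a (γ l 0) ^ 2
  future : ∀ l ∈ s, 0 < deriv γ l 0

/-- Three Jacobi fields transverse to an aligned geodesic with tangent `u`: the translations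
`e 0`, `e 1` orthogonal to the momentum, and the combination `p u + ε e 2` of the tangent with the
translation along the momentum, in components `(p u⁰, (u⁰)² e 2)`. -/
noncomputable def transverseFrame (γ : ℝ → Pt) (p : ℝ) (e : Fin 3 → Fin 3 → ℝ) (i : Fin 3) (l : ℝ) : Pt :=
  ![Fin.cons 0 (e 0), Fin.cons 0 (e 1),
    Fin.cons (p * deriv γ l 0) fun α => deriv γ l 0 ^ 2 * e 2 α] i

/-- The covariant derivative of `transverseFrame` along the geodesic. -/
noncomputable def transverseFrameD (a : ℝ → ℝ) (γ : ℝ → Pt) (ε p : ℝ) (e : Fin 3 → Fin 3 → ℝ) (i : Fin 3)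
    (l : ℝ) : Pt :=
  (deriv a (γ l 0) / a (γ l 0)) • (![Fin.cons 0 fun α => deriv γ l 0 * e 0 α,
    Fin.cons 0 fun α => deriv γ l 0 * e 1 α,
    Fin.cons (ε * p) fun α => ε * deriv γ l 0 * e 2 α] i : Pt)

/-- The squared norms of the vectors of `transverseFrame`, up to the factor `ε` of the last one. -/
noncomputable def frameScale (a : ℝ → ℝ) (γ : ℝ → Pt) (i : Fin 3) (l : ℝ) : ℝ :=
  ![a (γ l 0) ^ 2, a (γ l 0) ^ 2, a (γ l 0) ^ 2 * deriv γ l 0 ^ 2] i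

namespace IsAlignedGeodesic

variable {a : ℝ → ℝ} {γ : ℝ → Pt} {s : Set ℝ} {ε p : ℝ} {e : Fin 3 → Fin 3 → ℝ}

lemma metricProd_frame (h : IsAlignedGeodesic a γ s ε p e) {l : ℝ} (hl : l ∈ s) (i j : Fin 3) :
    metricProd (friedmannMetric a) (γ l) (transverseFrame γ p e i l) (transverseFrame γ p e j l)
      = if i = j then ![1, 1, ε] i * frameScale a γ i l else 0 := by
  have h0 := (h.regular l hl).2.ne'
  have hε : ε = deriv γ l 0 ^ 2 - p ^ 2 / a (γ l 0) ^ 2 := by rw [h.energy l hl]; ring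
  have ho : ∀ i j (x y : ℝ), ∑ α, (x * e i α) * (y * e j α) = x * y * if i = j then 1 else 0 := by
    intro i j x y
    rw [← h.orthonormal i j, Finset.mul_sum]
    exact Finset.sum_congr rfl fun α _ => by ring
  have ho1 := fun i j => ho i j 1
  have ho2 := fun i j x => ho i j x 1
  have ho3 := fun i j => ho i j 1 1
  simp only [one_mul, mul_one] at ho1 ho2 ho3
  rw [metricProd_friedmannMetric]
  fin_cases i <;> fin_cases j <;>
    simp [transverseFrame, frameScale, ho, ho1, ho2, ho3]
  rw [hε]
  field_simp
  ring

/-- Different vectors of the frame stay orthogonal under covariant differentiation, so that the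
deviation is free of vorticity. -/
lemma metricProd_frame_frameD (h : IsAlignedGeodesic a γ s ε p e) (l : ℝ) {i j : Fin 3}
    (hij : i ≠ j) :
    metricProd (friedmannMetric a) (γ l) (transverseFrame γ p e i l)
      (transverseFrameD a γ ε p e j l) = 0 := by
  have ho : ∀ i j (x y z : ℝ), i ≠ j → ∑ α, (x * e i α) * (y * (z * e j α)) = 0 := by
    intro i j x y z hij
    rw [← mul_zero (x * y * z), ← if_neg (c := i = j) (t := (1 : ℝ)) (e := 0) hij,
      ← h.orthonormal i j, Finset.mul_sum]
    exact Finset.sum_congr rfl fun α _ => by ring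
  have ho1 := fun i j => ho i j 1
  simp only [one_mul] at ho1
  rw [metricProd_friedmannMetric]
  fin_cases i <;> fin_cases j <;>
    simp [transverseFrame, transverseFrameD, ho, ho1] at hij ⊢

lemma metricProd_frame_tangent (h : IsAlignedGeodesic a γ s ε p e) {l : ℝ} (hl : l ∈ s)
    (i : Fin 3) :
    metricProd (friedmannMetric a) (γ l) (transverseFrame γ p e i l) (deriv γ l) = 0 := by
  have h0 := (h.regular l hl).2.ne'
  have ho : ∀ i (x y : ℝ), ∑ α, (x * e i α) * (y * e 2 α) = x * y * if i = 2 then 1 else 0 := by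
    intro i x y
    rw [← h.orthonormal i 2, Finset.mul_sum]
    exact Finset.sum_congr rfl fun α _ => by ring
  have ho1 := fun i => ho i 1
  simp only [one_mul] at ho1
  rw [metricProd_friedmannMetric]
  simp only [h.momentum l hl]
  fin_cases i <;> simp [transverseFrame, ho, ho1]
  field_simp
  ring

/-- Multiples `f` of the vectors of `transverseFrame` are Jacobi fields if `f'` is a constant
divided by the squared norm (reduction of order). For `f = 1`, `c = 0` these are the vectors
themselves. -/
lemma isJacobiOn_smul_frame (h : IsAlignedGeodesic a γ s ε p e) {c : ℝ} {i : Fin 3} {f : ℝ → ℝ}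
    (hf : ∀ l ∈ s, HasDerivAt f (c / frameScale a γ i l) l) :
    IsJacobiOn (friedmannMetric a) γ (fun l => f l • transverseFrame γ p e i l) s ∧
      ∀ l ∈ s, covD (friedmannMetric a) γ (fun l => f l • transverseFrame γ p e i l) l
        = (c / frameScale a γ i l) • transverseFrame γ p e i l
          + f l • transverseFrameD a γ ε p e i l := by
  have hd : ∀ l ∈ s, DifferentiableAt ℝ a (γ l 0) ∧ 0 < a (γ l 0) := fun l hl =>
    ⟨(h.regular l hl).1.differentiableAt (by norm_num), (h.regular l hl).2⟩
  have hg := (isGeodesicOn_friedmannMetric_iff hd).1 h.geodesic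
  have hγ : ∀ l ∈ s, HasDerivAt (fun l => γ l 0) (deriv γ l 0) l := fun l hl =>
    hasDerivAt_pi.1 (hg l hl).1.hasDerivAt 0
  have hA : ∀ l ∈ s, HasDerivAt (fun l => a (γ l 0)) (deriv a (γ l 0) * deriv γ l 0) l :=
    fun l hl => (hd l hl).1.hasDerivAt.comp l (hγ l hl)
  have hA' : ∀ l ∈ s, HasDerivAt (fun l => deriv a (γ l 0))
      (deriv (deriv a) (γ l 0) * deriv γ l 0) l := fun l hl =>
    HasDerivAt.comp (h₂ := deriv a) l (h.regular l hl).1.hasDerivAt_deriv_of_two.2 (hγ l hl)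
  have ho : ∀ i (x y : ℝ), ∑ α, (x * e 2 α) * (y * e i α) = x * y * if 2 = i then 1 else 0 := by
    intro i x y
    rw [← h.orthonormal 2 i, Finset.mul_sum]
    exact Finset.sum_congr rfl fun α _ => by ring
  have hu0 : ∀ l ∈ s, HasDerivAt (fun l => deriv γ l 0)
      (-(a (γ l 0) * deriv a (γ l 0) * (p / a (γ l 0) ^ 2 * (p / a (γ l 0) ^ 2)))) l := by
    intro l hl
    refine (hg l hl).2.1.congr_deriv ?_
    simp only [h.momentum l hl, ho]
    simp
  -- the two translations orthogonal to the momentum have the same form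
  have hperp : ∀ v : Fin 3 → ℝ, (∀ x y, ∑ α, (x * e 2 α) * (y * v α) = 0) →
      (∀ l ∈ s, HasDerivAt f (c / a (γ l 0) ^ 2) l) →
      IsJacobiOn (friedmannMetric a) γ (fun l => f l • (Fin.cons 0 v : Pt)) s ∧
      ∀ l ∈ s, covD (friedmannMetric a) γ (fun l => f l • (Fin.cons 0 v : Pt)) l
        = (Fin.cons 0 fun α => (c / a (γ l 0) ^ 2
          + deriv a (γ l 0) / a (γ l 0) * deriv γ l 0 * f l) * v α : Pt) := by
    intro v hv hf
    apply isJacobiOn_friedmannMetric h.isOpen h.regular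
    · intro l hl
      simp only [h.momentum l hl, Pi.smul_apply, Fin.cons_zero, Fin.cons_succ, smul_eq_mul, hv]
      simpa using hasDerivAt_const l (0 : ℝ)
    · intro l hl α
      simp only [Pi.smul_apply, Fin.cons_zero, Fin.cons_succ, smul_eq_mul]
      exact ((hf l hl).mul_const (v α)).congr_deriv (by ring)
    · intro l hl
      simp only [h.momentum l hl, Pi.smul_apply, Fin.cons_zero, Fin.cons_succ, smul_eq_mul, hv]
      simpa using hasDerivAt_const l (0 : ℝ)
    · intro l hl α
      have h0 := (hd l hl).2.ne'
      simp only [h.momentum l hl, Pi.smul_apply, Fin.cons_zero, Fin.cons_succ, smul_eq_mul, hv, ho]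
      refine (((((hasDerivAt_const l c).fun_div ((hA l hl).fun_pow 2) (pow_ne_zero 2 h0)).fun_add
        ((((hA' l hl).fun_div (hA l hl) h0).fun_mul (hu0 l hl)).fun_mul (hf l hl))).mul_const
        (v α))).congr_deriv ?_
      simp
      field_simp
      ring
  -- the equation `ε = (u⁰)² - p² / a²` turns the Jacobi equation into a rational identity
  have hpar : (∀ l ∈ s, HasDerivAt f (c / (a (γ l 0) ^ 2 * deriv γ l 0 ^ 2)) l) →
      IsJacobiOn (friedmannMetric a) γ (fun l => (Fin.cons (f l * (p * deriv γ l 0))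
        fun α => f l * deriv γ l 0 ^ 2 * e 2 α : Pt)) s ∧
      ∀ l ∈ s, covD (friedmannMetric a) γ (fun l => (Fin.cons (f l * (p * deriv γ l 0))
        fun α => f l * deriv γ l 0 ^ 2 * e 2 α : Pt)) l
        = (Fin.cons (c * p / (a (γ l 0) ^ 2 * deriv γ l 0)
            + deriv a (γ l 0) / a (γ l 0) * f l * (ε * p)) fun α => (c / a (γ l 0) ^ 2
          + deriv a (γ l 0) / a (γ l 0) * f l * (ε * deriv γ l 0)) * e 2 α : Pt) := by
    intro hf
    have hε : ∀ l ∈ s, ε = deriv γ l 0 ^ 2 - p ^ 2 / a (γ l 0) ^ 2 := fun l hl => by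
      rw [h.energy l hl]; ring
    have hH : ∀ l ∈ s, HasDerivAt (fun l => deriv a (γ l 0) / a (γ l 0)) _ l := fun l hl =>
      (hA' l hl).fun_div (hA l hl) (hd l hl).2.ne'
    apply isJacobiOn_friedmannMetric h.isOpen h.regular
    · intro l hl
      have h0 := (hd l hl).2.ne'
      have h1 := (h.future l hl).ne'
      simp only [h.momentum l hl, Fin.cons_zero, Fin.cons_succ, ho]
      refine ((hf l hl).fun_mul ((hu0 l hl).const_mul p)).congr_deriv ?_
      rw [hε l hl]
      simp
      field_simp
      ring
    · intro l hl α
      have h0 := (hd l hl).2.ne'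
      have h1 := (h.future l hl).ne'
      simp only [h.momentum l hl, Fin.cons_zero, Fin.cons_succ]
      refine (((hf l hl).fun_mul ((hu0 l hl).fun_pow 2)).mul_const (e 2 α)).congr_deriv ?_
      rw [hε l hl]
      simp
      field_simp
      ring
    · intro l hl
      have h0 := (hd l hl).2.ne'
      have h1 := (h.future l hl).ne'
      simp only [h.momentum l hl, Fin.cons_zero, Fin.cons_succ, ho]
      refine (((hasDerivAt_const l (c * p)).fun_div (((hA l hl).fun_pow 2).fun_mul (hu0 l hl))
        (by positivity)).fun_add (((hH l hl).fun_mul (hf l hl)).mul_const (ε * p))).congr_deriv ?_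
      rw [hε l hl]
      simp
      field_simp
      ring
    · intro l hl α
      have h0 := (hd l hl).2.ne'
      have h1 := (h.future l hl).ne'
      simp only [h.momentum l hl, Fin.cons_zero, Fin.cons_succ, ho]
      refine ((((hasDerivAt_const l c).fun_div ((hA l hl).fun_pow 2)
        (by positivity)).fun_add (((hH l hl).fun_mul (hf l hl)).fun_mul
          ((hu0 l hl).const_mul ε))).mul_const (e 2 α)).congr_deriv ?_
      rw [hε l hl]
      simp
      field_simp
      ring
  have hz : ∀ i : Fin 3, i ≠ 2 → ∀ x y, ∑ α, (x * e 2 α) * (y * e i α) = 0 := by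
    intro i hi x y
    rw [ho, if_neg hi.symm, mul_zero]
  fin_cases i
  · refine ⟨(hperp (e 0) (hz 0 (by decide)) hf).1, fun l hl => ?_⟩
    refine ((hperp (e 0) (hz 0 (by decide)) hf).2 l hl).trans ?_
    funext μ
    refine Fin.cases ?_ (fun α => ?_) μ <;> simp [transverseFrame, transverseFrameD, frameScale]
    ring
  · refine ⟨(hperp (e 1) (hz 1 (by decide)) hf).1, fun l hl => ?_⟩
    refine ((hperp (e 1) (hz 1 (by decide)) hf).2 l hl).trans ?_
    funext μ
    refine Fin.cases ?_ (fun α => ?_) μ <;> simp [transverseFrame, transverseFrameD, frameScale]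
    ring
  · have heq : (fun l => f l • transverseFrame γ p e 2 l) =
        (fun l => (Fin.cons (f l * (p * deriv γ l 0))
        fun α => f l * deriv γ l 0 ^ 2 * e 2 α : Pt)) := by
      funext l μ
      refine Fin.cases ?_ (fun α => ?_) μ <;> simp [transverseFrame, mul_assoc]
    rw [← heq] at hpar
    refine ⟨(hpar hf).1, fun l hl => ((hpar hf).2 l hl).trans ?_⟩
    have h0 := (hd l hl).2.ne'
    have h1 := (h.future l hl).ne'
    funext μ
    refine Fin.cases ?_ (fun α => ?_) μ <;>
    · simp [transverseFrame, transverseFrameD, frameScale]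
      field_simp

/-- The derivative of the squared norms along the geodesic. -/
lemma hasDerivAt_frameScale (h : IsAlignedGeodesic a γ s ε p e) {l : ℝ} (hl : l ∈ s) (i : Fin 3) :
    HasDerivAt (frameScale a γ i)
      (2 * (![1, 1, ε] i * (a (γ l 0) * deriv a (γ l 0) * deriv γ l 0))) l := by
  have hd : ∀ l ∈ s, DifferentiableAt ℝ a (γ l 0) ∧ 0 < a (γ l 0) := fun l hl =>
    ⟨(h.regular l hl).1.differentiableAt (by norm_num), (h.regular l hl).2⟩
  have h0 := (hd l hl).2.ne'
  have hg := (isGeodesicOn_friedmannMetric_iff hd).1 h.geodesic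
  have hA : HasDerivAt (fun l => a (γ l 0)) (deriv a (γ l 0) * deriv γ l 0) l :=
    (hd l hl).1.hasDerivAt.comp l (hasDerivAt_pi.1 (hg l hl).1.hasDerivAt 0)
  have hA2 : HasDerivAt (fun l => a (γ l 0) ^ 2)
      (2 * (a (γ l 0) * deriv a (γ l 0) * deriv γ l 0)) l :=
    (hA.fun_pow 2).congr_deriv (by simp; ring)
  -- the last scale is `ε a² + p²` by conservation of energy
  have hev : frameScale a γ 2 =ᶠ[𝓝 l] fun l => ε * a (γ l 0) ^ 2 + p ^ 2 := by
    filter_upwards [h.isOpen.mem_nhds hl] with m hm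
    have := (hd m hm).2.ne'
    simp only [frameScale, h.energy m hm]
    simp
    field_simp
  have h2 : HasDerivAt (frameScale a γ 2)
      (2 * (ε * (a (γ l 0) * deriv a (γ l 0) * deriv γ l 0))) l :=
    (((hA2.const_mul ε).add_const (p ^ 2)).congr_deriv (by ring)).congr_of_eventuallyEq hev
  fin_cases i
  · exact hA2.congr_deriv (by simp)
  · exact hA2.congr_deriv (by simp)
  · exact h2

lemma frameScale_pos (h : IsAlignedGeodesic a γ s ε p e) {l : ℝ} (hl : l ∈ s) (i : Fin 3) :
    0 < frameScale a γ i l := by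
  have h0 := (h.regular l hl).2
  have h1 := h.future l hl
  fin_cases i <;> simp [frameScale] <;> positivity

end IsAlignedGeodesic

/-! ### Volumes and expansions of congruences -/

lemma metricProd_smul_smul (g : MetricField) (x v w : Pt) (c d : ℝ) :
    metricProd g x (c • v) (d • w) = c * d * metricProd g x v w := by
  simp only [metricProd, Pi.smul_apply, smul_eq_mul, Finset.mul_sum]
  exact Finset.sum_congr rfl fun _ _ => Finset.sum_congr rfl fun _ _ => by ring

lemma metricProd_sum_smul (g : MetricField) (x v : Pt) {k : ℕ} (w : Fin k → Pt) (c : Fin k → ℝ) :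
    metricProd g x v (∑ j, c j • w j) = ∑ j, metricProd g x v (w j) * c j := by
  simp only [metricProd, Finset.sum_apply, Pi.smul_apply, smul_eq_mul, Finset.mul_sum,
    Finset.sum_mul]
  rw [Finset.sum_comm_cycle]
  exact Finset.sum_congr rfl fun _ _ => Finset.sum_congr rfl fun _ _ =>
    Finset.sum_congr rfl fun _ _ => by ring

lemma linearIndependent_of_gram_det_ne_zero (g : MetricField) (x : Pt) {k : ℕ} (v : Fin k → Pt)
    (h : (gram g x v).det ≠ 0) : LinearIndependent ℝ v := by
  rw [Fintype.linearIndependent_iff]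
  intro c hc
  refine congrFun (Matrix.eq_zero_of_mulVec_eq_zero h (v := c) ?_)
  funext i
  have := metricProd_sum_smul g x (v i) v c
  rw [hc] at this
  simpa [Matrix.mulVec, dotProduct, gram, metricProd] using this.symm

/-- Differentiation of a primitive on an open interval on which the integrand is continuous. -/
lemma hasDerivAt_integral_of_continuousOn {φ : ℝ → ℝ} {s : Set ℝ} (hs : IsOpen s)
    (hc : s.OrdConnected) (hφ : ContinuousOn φ s) {q l : ℝ} (hq : q ∈ s) (hl : l ∈ s) :
    HasDerivAt (fun l => ∫ r in q..l, φ r) (φ l) l :=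
  intervalIntegral.integral_hasDerivAt_right
    (hφ.mono (hc.uIcc_subset hq hl)).intervalIntegrable
    (hφ.stronglyMeasurableAtFilter hs l hl) (hφ.continuousAt (hs.mem_nhds hl))

lemma metricProd_comm_friedmannMetric (a : ℝ → ℝ) (x v w : Pt) :
    metricProd (friedmannMetric a) x v w = metricProd (friedmannMetric a) x w v := by
  simp only [metricProd_friedmannMetric, mul_comm]

namespace IsAlignedGeodesic

variable {a : ℝ → ℝ} {γ : ℝ → Pt} {s : Set ℝ} {ε p : ℝ} {e : Fin 3 → Fin 3 → ℝ}

lemma gram_smul_frame (h : IsAlignedGeodesic a γ s ε p e) {l : ℝ} (hl : l ∈ s) {k : ℕ}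
    {ι : Fin k → Fin 3} (hι : Function.Injective ι) (x : Fin k → ℝ) :
    gram (friedmannMetric a) (γ l) (fun j => x j • transverseFrame γ p e (ι j) l)
      = Matrix.diagonal fun j => x j ^ 2 * (![1, 1, ε] (ι j) * frameScale a γ (ι j) l) := by
  ext i j
  rw [gram, Matrix.of_apply, metricProd_smul_smul, h.metricProd_frame hl, Matrix.diagonal_apply]
  by_cases hij : i = j
  · subst hij
    simp [sq]
  · simp [hij, hι.ne hij]

lemma metricProd_frame_frameD_comm (h : IsAlignedGeodesic a γ s ε p e) (l : ℝ) (i j : Fin 3) :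
    metricProd (friedmannMetric a) (γ l) (transverseFrame γ p e i l)
      (transverseFrameD a γ ε p e j l)
    = metricProd (friedmannMetric a) (γ l) (transverseFrameD a γ ε p e i l)
      (transverseFrame γ p e j l) := by
  by_cases hij : i = j
  · subst hij
    exact metricProd_comm_friedmannMetric ..
  · rw [h.metricProd_frame_frameD l hij, metricProd_comm_friedmannMetric,
      h.metricProd_frame_frameD l (Ne.symm hij)]

/-- The volume spanned by the vectors of the transverse frame has a nonzero limit if the scale
factor and the energy have one. -/
theorem not_allVolumesVanish {l₀ lS : ℝ} (hlt : l₀ < lS)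
    (h : IsAlignedGeodesic a γ (Ioo l₀ lS) ε p e) {m : Fin 3 → ℝ} (hm : ∀ i, 0 < m i)
    (hlim : ∀ i, Tendsto (frameScale a γ i) (𝓝[<] lS) (𝓝 (m i))) {k : ℕ} {ι : Fin k → Fin 3}
    (hι : Function.Injective ι) (hκ : ∀ j, 0 < (![1, 1, ε] : Fin 3 → ℝ) (ι j)) :
    ¬ AllVolumesVanish k (friedmannMetric a) γ l₀ lS := by
  intro H
  have hJ := fun i => h.isJacobiOn_smul_frame (i := i) (c := 0) (f := fun _ => 1)
    fun l _ => by simpa using hasDerivAt_const l (1 : ℝ)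
  simp only [one_smul, zero_div, zero_smul, zero_add] at hJ
  have hgram : ∀ l ∈ Ioo l₀ lS, (gram (friedmannMetric a) (γ l)
      (fun j => transverseFrame γ p e (ι j) l)).det
      = ∏ j, (![1, 1, ε] : Fin 3 → ℝ) (ι j) * frameScale a γ (ι j) l := fun l hl => by
    have := h.gram_smul_frame hl hι fun _ => 1
    simp only [one_smul, one_pow, one_mul] at this
    rw [this, Matrix.det_diagonal]
  have hV := H (fun j => transverseFrame γ p e (ι j))
    (fun j => ⟨(hJ (ι j)).1, fun l hl => h.metricProd_frame_tangent hl (ι j)⟩)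
    (fun i j l hl => by
      rw [(hJ (ι i)).2 l hl, (hJ (ι j)).2 l hl]
      exact h.metricProd_frame_frameD_comm l (ι i) (ι j)) ?_
  · have hV' : Tendsto (volElem (friedmannMetric a) γ fun j => transverseFrame γ p e (ι j))
        (𝓝[<] lS) (𝓝 (Real.sqrt (∏ j, (![1, 1, ε] : Fin 3 → ℝ) (ι j) * m (ι j)))) := by
      refine Tendsto.congr' ?_ (Real.continuous_sqrt.continuousAt.tendsto.comp
        (tendsto_finsetProd _ fun j _ => (hlim (ι j)).const_mul _))
      filter_upwards [Ioo_mem_nhdsLT hlt] with l hl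
      simp only [Function.comp, volElem]
      rw [hgram l hl]
    have := tendsto_nhds_unique hV hV'
    exact (Real.sqrt_pos.2 (Finset.prod_pos fun j _ => mul_pos (hκ j) (hm (ι j)))).ne this
  · obtain ⟨l, hl⟩ := exists_between hlt
    refine LinearIndependent.of_comp (LinearMap.proj (R := ℝ) (⟨l, hl⟩ : Ioo l₀ lS)) ?_
    refine linearIndependent_of_gram_det_ne_zero (friedmannMetric a) (γ l) _ ?_
    refine ((hgram l hl).trans_ne ?_)
    exact (Finset.prod_pos fun j _ => mul_pos (hκ j) (h.frameScale_pos hl (ι j))).ne'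

/-- Close to the end of the geodesic the growth of the deviation vectors that start at `q`
outweighs the bounded contraction of the scale factor. -/
lemma eventually_growth_nonneg {l₀ lS : ℝ} (hlt : l₀ < lS) {m : Fin 3 → ℝ} (hm : ∀ i, 0 < m i)
    (hlim : ∀ i, Tendsto (frameScale a γ i) (𝓝[<] lS) (𝓝 (m i))) {β : ℝ}
    (hβ : Tendsto (fun l => a (γ l 0) * deriv a (γ l 0) * deriv γ l 0) (𝓝[<] lS) (𝓝 β))
    (i : Fin 3) :
    ∀ᶠ q in 𝓝[<] lS, ∀ l ∈ Ioo q lS, 0 ≤ (∫ r in q..l, 1 / frameScale a γ i r) ∧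
      0 ≤ 1 + (∫ r in q..l, 1 / frameScale a γ i r) *
        ((![1, 1, ε] : Fin 3 → ℝ) i * (a (γ l 0) * deriv a (γ l 0) * deriv γ l 0)) := by
  set κ := (![1, 1, ε] : Fin 3 → ℝ) i
  set C := |κ * β| + 1
  have hC : 0 < C := by positivity
  have e1 : ∀ᶠ l in 𝓝[<] lS, |κ * (a (γ l 0) * deriv a (γ l 0) * deriv γ l 0)| < C :=
    (hβ.const_mul κ).abs.eventually_lt_const (lt_add_one _)
  have e2 : ∀ᶠ l in 𝓝[<] lS, m i / 2 < frameScale a γ i l :=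
    (hlim i).eventually_const_lt (half_lt_self (hm i))
  obtain ⟨q₀, hq₀, hq₀'⟩ := (mem_nhdsLT_iff_exists_Ioo_subset).1 (e1.and e2)
  have hδ : lS - m i / 2 / C < lS := by
    have := div_pos (half_pos (hm i)) hC
    linarith
  filter_upwards [Ioo_mem_nhdsLT hlt, Ioo_mem_nhdsLT hq₀, Ioo_mem_nhdsLT hδ] with q hq hq1 hq2 l hl
  have hsub : ∀ r ∈ Icc q l, r ∈ Ioo l₀ lS ∧ m i / 2 < frameScale a γ i r := fun r hr =>
    ⟨⟨hq.1.trans_le hr.1, hr.2.trans_lt hl.2⟩,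
      (hq₀' ⟨hq1.1.trans_le hr.1, hr.2.trans_lt hl.2⟩).2⟩
  have hm2 := half_pos (hm i)
  have hnn : 0 ≤ ∫ r in q..l, 1 / frameScale a γ i r :=
    intervalIntegral.integral_nonneg hl.1.le fun r hr =>
      (one_div_pos.2 (hm2.trans (hsub r hr).2)).le
  refine ⟨hnn, ?_⟩
  have hle : |∫ r in q..l, 1 / frameScale a γ i r| ≤ 1 / (m i / 2) * |l - q| := by
    rw [← Real.norm_eq_abs]
    refine intervalIntegral.norm_integral_le_of_norm_le_const fun r hr => ?_
    rw [uIoc_of_le hl.1.le] at hr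
    have := (hsub r (Ioc_subset_Icc_self hr)).2
    rw [Real.norm_eq_abs, abs_of_pos (one_div_pos.2 (hm2.trans this))]
    exact one_div_le_one_div_of_le hm2 this.le
  have hT := (hq₀' ⟨hq1.1.trans hl.1, hl.2⟩).1.le
  have hlen : |l - q| ≤ m i / 2 / C := by
    rw [abs_of_pos (sub_pos.2 hl.1)]
    linarith [hq2.1, hl.2]
  have habs : |(∫ r in q..l, 1 / frameScale a γ i r) *
      (κ * (a (γ l 0) * deriv a (γ l 0) * deriv γ l 0))| ≤ 1 := by
    rw [abs_mul]
    calc _ ≤ (1 / (m i / 2) * (m i / 2 / C)) * C := by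
          gcongr
          exact hle.trans (by gcongr)
      _ = 1 := by
          have := (hm i).ne'
          field_simp
  linarith [neg_abs_le ((∫ r in q..l, 1 / frameScale a γ i r) *
      (κ * (a (γ l 0) * deriv a (γ l 0) * deriv γ l 0)))]

/-- The congruence emanating from a point close to the singularity has nonnegative expansion. -/
theorem not_allExpansionsBecomeNegative {l₀ lS : ℝ} (hlt : l₀ < lS)
    (h : IsAlignedGeodesic a γ (Ioo l₀ lS) ε p e) {m : Fin 3 → ℝ} (hm : ∀ i, 0 < m i)
    (hlim : ∀ i, Tendsto (frameScale a γ i) (𝓝[<] lS) (𝓝 (m i))) {β : ℝ}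
    (hβ : Tendsto (fun l => a (γ l 0) * deriv a (γ l 0) * deriv γ l 0) (𝓝[<] lS) (𝓝 β))
    {k : ℕ} {ι : Fin k → Fin 3}
    (hι : Function.Injective ι) (hκ : ∀ j, 0 < (![1, 1, ε] : Fin 3 → ℝ) (ι j)) :
    ¬ AllExpansionsBecomeNegative k (friedmannMetric a) γ l₀ lS := by
  intro H
  obtain ⟨q, hgrow, hq⟩ := ((eventually_all.2 (eventually_growth_nonneg hlt hm hlim hβ)).and
    (Ioo_mem_nhdsLT hlt)).exists
  set F : Fin 3 → ℝ → ℝ := fun i l => ∫ r in q..l, 1 / frameScale a γ i r with hF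
  have hFd : ∀ i, ∀ l ∈ Ioo l₀ lS, HasDerivAt (F i) (1 / frameScale a γ i l) l := fun i l hl =>
    hasDerivAt_integral_of_continuousOn isOpen_Ioo ordConnected_Ioo
      (continuousOn_const.div (fun r hr =>
        (h.hasDerivAt_frameScale hr i).continuousAt.continuousWithinAt)
        fun r hr => (h.frameScale_pos hr i).ne') hq hl
  have hF0 : ∀ i, F i q = 0 := fun i => intervalIntegral.integral_same
  have hJ := fun i => h.isJacobiOn_smul_frame (i := i) (hFd i)
  obtain ⟨l, hl, hneg⟩ := H q hq (fun j l => F (ι j) l • transverseFrame γ p e (ι j) l)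
    (fun j => ⟨(hJ (ι j)).1, fun l hl => by
      have := metricProd_smul_smul (friedmannMetric a) (γ l)
        (transverseFrame γ p e (ι j) l) (deriv γ l) (F (ι j) l) 1
      rwa [one_smul, h.metricProd_frame_tangent hl, mul_zero] at this⟩)
    (fun j => by simp [hF0])
    (by
      simp only [(hJ _).2 q hq, hF0, zero_smul, add_zero]
      rw [h.gram_smul_frame hq hι fun j => 1 / frameScale a γ (ι j) q, Matrix.det_diagonal]
      refine (Finset.prod_pos fun j _ => ?_).ne'
      have := h.frameScale_pos hq (ι j)
      have := hκ j
      positivity)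
  -- Each factor `f² κ M` of the Gram determinant increases: as `f' M = 1`, its derivative is
  -- `2 κ f (1 + f κ a ȧ u⁰)`.
  have hmono : ∀ i, 0 < (![1, 1, ε] : Fin 3 → ℝ) i →
      MonotoneOn (fun l => F i l ^ 2 * ((![1, 1, ε] : Fin 3 → ℝ) i * frameScale a γ i l))
        (Ioo q lS) := by
    intro i hi
    have hsub : ∀ l ∈ Ioo q lS, l ∈ Ioo l₀ lS := fun l hl => ⟨hq.1.trans hl.1, hl.2⟩
    have hd := fun l (hl : l ∈ Ioo q lS) => ((hFd i l (hsub l hl)).fun_pow 2).fun_mul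
      ((h.hasDerivAt_frameScale (hsub l hl) i).const_mul ((![1, 1, ε] : Fin 3 → ℝ) i))
    refine monotoneOn_of_deriv_nonneg (convex_Ioo _ _)
      (fun l hl => (hd l hl).continuousAt.continuousWithinAt)
      (fun l hl => (hd l (interior_subset hl)).differentiableAt.differentiableWithinAt)
      fun l hl => ?_
    replace hl := interior_subset hl
    rw [(hd l hl).deriv]
    obtain ⟨g1, g2⟩ := hgrow i l hl
    have hM := (h.frameScale_pos (hsub l hl) i).ne'
    refine (mul_nonneg (mul_nonneg (mul_nonneg zero_le_two hi.le) g1) g2).trans_eq ?_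
    simp only [hF]
    field_simp
    simp
    ring
  have hVmono : MonotoneOn (volElem (friedmannMetric a) γ
      fun j l => F (ι j) l • transverseFrame γ p e (ι j) l) (Ioo q lS) := by
    intro l₁ h₁ l₂ h₂ h12
    have hd : ∀ l ∈ Ioo q lS, volElem (friedmannMetric a) γ
        (fun j l => F (ι j) l • transverseFrame γ p e (ι j) l) l = Real.sqrt (∏ j,
          F (ι j) l ^ 2 * ((![1, 1, ε] : Fin 3 → ℝ) (ι j) * frameScale a γ (ι j) l)) := by
      intro l hl
      rw [volElem, h.gram_smul_frame ⟨hq.1.trans hl.1, hl.2⟩ hι fun j => F (ι j) l,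
        Matrix.det_diagonal]
    rw [hd l₁ h₁, hd l₂ h₂]
    refine Real.sqrt_le_sqrt (Finset.prod_le_prod (fun j _ => ?_)
      fun j _ => hmono (ι j) (hκ j) h₁ h₂ h12)
    have := h.frameScale_pos ⟨hq.1.trans h₁.1, h₁.2⟩ (ι j)
    have := hκ j
    positivity
  refine absurd hneg (not_lt.2 (div_nonneg ?_ (Real.sqrt_nonneg _)))
  rw [← derivWithin_of_isOpen isOpen_Ioo hl]
  exact hVmono.derivWithin_nonneg

end IsAlignedGeodesic

/-- Every vector of `ℝ³` is a multiple of the last vector of an orthonormal frame. -/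
lemma exists_orthonormal_frame (P : Fin 3 → ℝ) :
    ∃ (p : ℝ) (e : Fin 3 → Fin 3 → ℝ), (∀ i j, ∑ α, e i α * e j α = if i = j then 1 else 0) ∧
      ∀ α, P α = p * e 2 α := by
  obtain ⟨b, hb⟩ : ∃ b : OrthonormalBasis (Fin 3) ℝ (EuclideanSpace ℝ (Fin 3)),
      WithLp.toLp 2 P = ‖WithLp.toLp 2 P‖ • b 2 := by
    set x : EuclideanSpace ℝ (Fin 3) := WithLp.toLp 2 P
    by_cases hx : x = 0
    · exact ⟨EuclideanSpace.basisFun _ _, by simp [hx]⟩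
    · have hv : Orthonormal ℝ (({2} : Set (Fin 3)).domRestrict fun _ => ‖x‖⁻¹ • x) := by
        refine ⟨fun i => ?_, fun i j hij => absurd (Subsingleton.elim i j) hij⟩
        simp [norm_smul, hx]
      obtain ⟨b, hb⟩ := hv.exists_orthonormalBasis_extension_of_card_eq (by simp)
      refine ⟨b, ?_⟩
      rw [hb 2 rfl, smul_smul, mul_inv_cancel₀ (norm_ne_zero_iff.2 hx), one_smul]
  refine ⟨‖WithLp.toLp 2 P‖, fun i α => b i α, fun i j => ?_, fun α => ?_⟩
  · rw [← orthonormal_iff_ite.1 b.orthonormal i j]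
    simp [PiLp.inner_apply, mul_comm]
  · simpa using congrArg (fun x : EuclideanSpace ℝ (Fin 3) => x α) hb

/-! ### Sudden singularities are weak -/

/-- The first integrals of a causal geodesic: `ε` is nonnegative, and `ε` and the momentum do not
both vanish. -/
lemma IsCausalGeodesicInto.exists_momentum {a : ℝ → ℝ} {t₀ tS : ℝ} {γ : ℝ → Pt} {l₀ lS : ℝ}
    (hγ : IsCausalGeodesicInto a t₀ tS γ l₀ lS)
    (hreg : ∀ l ∈ Ioo l₀ lS, DifferentiableAt ℝ a (γ l 0) ∧ 0 < a (γ l 0)) :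
    ∃ (ε : ℝ) (P : Fin 3 → ℝ), 0 ≤ ε ∧ (∀ y, 0 < y → 0 < ε + (∑ α, P α ^ 2) / y ^ 2) ∧
      ∀ l ∈ Ioo l₀ lS, (∀ α, deriv γ l α.succ = P α / a (γ l 0) ^ 2) ∧
        deriv γ l 0 ^ 2 = ε + (∑ α, P α ^ 2) / a (γ l 0) ^ 2 ∧
        metricProd (friedmannMetric a) (γ l) (deriv γ l) (deriv γ l) = -ε := by
  obtain ⟨ε, P, hP⟩ := exists_firstIntegrals isOpen_Ioo isPreconnected_Ioo hreg hγ.geodesic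
  have hnorm : ∀ l ∈ Ioo l₀ lS, metricProd (friedmannMetric a) (γ l) (deriv γ l) (deriv γ l)
      = -ε := by
    intro l hl
    have h0 := (hreg l hl).2.ne'
    rw [metricProd_friedmannMetric, ← sq, (hP l hl).2, Finset.mul_sum, Finset.sum_div, neg_add,
      add_assoc, ← Finset.sum_neg_distrib, ← Finset.sum_add_distrib, Finset.sum_eq_zero, add_zero]
    intro α _
    rw [(hP l hl).1 α]
    field_simp
    simp
  obtain ⟨l, hl⟩ := exists_between hγ.lt
  have hε : 0 ≤ ε := by
    have := hγ.causal l hl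
    rw [hnorm l hl] at this
    linarith
  have hQ : 0 ≤ ∑ α, P α ^ 2 := Finset.sum_nonneg fun α _ => sq_nonneg _
  refine ⟨ε, P, hε, fun y hy => ?_, fun l hl => ⟨(hP l hl).1, (hP l hl).2, hnorm l hl⟩⟩
  rcases hε.lt_or_eq with h1 | h1
  · positivity
  · have h3 := pow_pos (hγ.future l hl) 2
    rw [(hP l hl).2, ← h1, zero_add] at h3
    have h4 : 0 < ∑ α, P α ^ 2 := hQ.lt_of_ne fun h => by simp [← h] at h3
    positivity

namespace IsSuddenSingularity

variable {a : ℝ → ℝ} {t₀ tS aS HS : ℝ}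

lemma contDiffAt (hS : IsSuddenSingularity a t₀ tS aS HS) {t : ℝ} (ht : t ∈ Ioo t₀ tS) :
    ContDiffAt ℝ 2 a t :=
  hS.contDiffOn.contDiffAt (isOpen_Ioo.mem_nhds ht)

lemma tendsto_deriv (hS : IsSuddenSingularity a t₀ tS aS HS) :
    Tendsto (deriv a) (𝓝[<] tS) (𝓝 (HS * aS)) := by
  refine (hS.tendsto_hubble.mul hS.tendsto_scale).congr' ?_
  filter_upwards [Ioo_mem_nhdsLT hS.lt] with t ht
  have := (hS.pos t ht).ne'
  rw [hubble, div_mul_cancel₀ _ this]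

lemma hasDerivAt_hubble (hS : IsSuddenSingularity a t₀ tS aS HS) {t : ℝ} (ht : t ∈ Ioo t₀ tS) :
    HasDerivAt (hubble a) (deriv (deriv a) t / a t - hubble a t ^ 2) t := by
  obtain ⟨h1, h2⟩ := (hS.contDiffAt ht).hasDerivAt_deriv_of_two
  have h0 := (hS.pos t ht).ne'
  refine (h2.fun_div h1 h0).congr_deriv ?_
  rw [hubble]
  field_simp

/-- Neither kind of strong singularity occurs on a causal geodesic. -/
theorem not_strong (hS : IsSuddenSingularity a t₀ tS aS HS) {γ : ℝ → Pt} {l₀ lS : ℝ}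
    (hγ : IsCausalGeodesicInto a t₀ tS γ l₀ lS) :
    ¬ TiplerStrong (friedmannMetric a) γ l₀ lS ∧ ¬ KrolakStrong (friedmannMetric a) γ l₀ lS := by
  have hreg : ∀ l ∈ Ioo l₀ lS, DifferentiableAt ℝ a (γ l 0) ∧ 0 < a (γ l 0) := fun l hl =>
    ⟨(hS.contDiffAt (hγ.mem l hl)).differentiableAt (by norm_num), hS.pos _ (hγ.mem l hl)⟩
  obtain ⟨ε, P, hε, hpos, hP⟩ := hγ.exists_momentum hreg
  obtain ⟨p, e, he, hPe⟩ := exists_orthonormal_frame P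
  have hsq : ∑ α, P α ^ 2 = p ^ 2 := by
    calc ∑ α, P α ^ 2 = p ^ 2 * ∑ α, e 2 α * e 2 α := by
          rw [Finset.mul_sum]
          exact Finset.sum_congr rfl fun α _ => by rw [hPe]; ring
      _ = p ^ 2 := by rw [he]; simp
  have h : IsAlignedGeodesic a γ (Ioo l₀ lS) ε p e :=
    { isOpen := isOpen_Ioo
      regular := fun l hl => ⟨hS.contDiffAt (hγ.mem l hl), hS.pos _ (hγ.mem l hl)⟩
      geodesic := hγ.geodesic
      orthonormal := he
      momentum := fun l hl α => by rw [(hP l hl).1, hPe]; ring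
      energy := fun l hl => by rw [(hP l hl).2.1, hsq]
      future := hγ.future }
  have hnorm := fun l hl => (hP l hl).2.2
  -- the limits along the geodesic
  have htend : Tendsto (fun l => γ l 0) (𝓝[<] lS) (𝓝[<] tS) :=
    tendsto_nhdsWithin_iff.2 ⟨hγ.tendsto, by
      filter_upwards [Ioo_mem_nhdsLT hγ.lt] with l hl using (hγ.mem l hl).2⟩
  have hA : Tendsto (fun l => a (γ l 0)) (𝓝[<] lS) (𝓝 aS) := hS.tendsto_scale.comp htend
  have hA' : Tendsto (fun l => deriv a (γ l 0)) (𝓝[<] lS) (𝓝 (HS * aS)) :=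
    hS.tendsto_deriv.comp htend
  have haS := hS.aS_pos
  have hu2 : Tendsto (fun l => deriv γ l 0 ^ 2) (𝓝[<] lS) (𝓝 (ε + p ^ 2 / aS ^ 2)) := by
    refine ((tendsto_const_nhds (x := p ^ 2)).div (hA.pow 2)
      (by positivity)).const_add ε |>.congr' ?_
    filter_upwards [Ioo_mem_nhdsLT hγ.lt] with l hl using (h.energy l hl).symm
  have hu : Tendsto (fun l => deriv γ l 0) (𝓝[<] lS) (𝓝 √(ε + p ^ 2 / aS ^ 2)) := by
    refine (Real.continuous_sqrt.continuousAt.tendsto.comp hu2).congr' ?_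
    filter_upwards [Ioo_mem_nhdsLT hγ.lt] with l hl
    exact Real.sqrt_sq (h.future l hl).le
  replace hpos := hpos aS haS
  rw [hsq] at hpos
  have hlim : ∀ i, Tendsto (frameScale a γ i) (𝓝[<] lS)
      (𝓝 ((![aS ^ 2, aS ^ 2, aS ^ 2 * (ε + p ^ 2 / aS ^ 2)] : Fin 3 → ℝ) i)) := by
    intro i
    fin_cases i
    · exact hA.pow 2
    · exact hA.pow 2
    · exact (hA.pow 2).mul hu2
  have hm : ∀ i, 0 < (![aS ^ 2, aS ^ 2, aS ^ 2 * (ε + p ^ 2 / aS ^ 2)] : Fin 3 → ℝ) i := by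
    intro i
    fin_cases i <;> simp <;> positivity
  have hβ := (hA.mul hA').mul hu
  rcases hε.lt_or_eq with hε | hε
  · have ht : IsTimelikeOn (friedmannMetric a) γ (Ioo l₀ lS) := fun l hl => by
      rw [hnorm l hl]; linarith
    have hκ : ∀ j : Fin 3, 0 < (![1, 1, ε] : Fin 3 → ℝ) (id j) := by
      intro j
      fin_cases j <;> simp [hε]
    exact ⟨fun H => h.not_allVolumesVanish hγ.lt hm hlim Function.injective_id hκ (H.1 ht),
      fun H => h.not_allExpansionsBecomeNegative hγ.lt hm hlim hβ Function.injective_id hκ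
        (H.1 ht)⟩
  · have ht : IsNullOn (friedmannMetric a) γ (Ioo l₀ lS) := fun l hl => by
      refine ⟨fun h0 => (h.future l hl).ne' (by rw [h0]; rfl), ?_⟩
      rw [hnorm l hl, ← hε, neg_zero]
    -- the last vector of the frame is null here, and the two remaining ones suffice
    have hκ : ∀ j : Fin 2, 0 < (![1, 1, ε] : Fin 3 → ℝ) j.castSucc := by
      intro j
      fin_cases j <;> simp
    exact ⟨fun H => h.not_allVolumesVanish hγ.lt hm hlim (Fin.castSucc_injective 2) hκ (H.2 ht),
      fun H => h.not_allExpansionsBecomeNegative hγ.lt hm hlim hβ (Fin.castSucc_injective 2) hκ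
        (H.2 ht)⟩

/-! ### Comoving observers and the curvature integrals -/

lemma hasDerivAt_comoving (ξ : Fin 3 → ℝ) (t : ℝ) :
    HasDerivAt (comoving ξ) (Fin.cons 1 fun _ => 0 : Pt) t :=
  hasDerivAt_cons (hasDerivAt_id t) fun α => hasDerivAt_const t (ξ α)

theorem comoving_isCausalGeodesicInto (hS : IsSuddenSingularity a t₀ tS aS HS)
    (ξ : Fin 3 → ℝ) : IsCausalGeodesicInto a t₀ tS (comoving ξ) t₀ tS ∧
      IsTimelikeOn (friedmannMetric a) (comoving ξ) (Ioo t₀ tS) := by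
  have hd : deriv (comoving ξ) = fun _ => (Fin.cons 1 fun _ => 0 : Pt) :=
    funext fun t => (hasDerivAt_comoving ξ t).deriv
  have hnorm : ∀ l, metricProd (friedmannMetric a) (comoving ξ l) (deriv (comoving ξ) l)
      (deriv (comoving ξ) l) = -1 := fun l => by
    simp [metricProd_friedmannMetric, hd]
  refine ⟨⟨hS.lt, fun l hl => hl, ?_, fun l _ => ?_, fun l _ => ?_, ?_⟩, fun l _ => ?_⟩
  · rw [isGeodesicOn_friedmannMetric_iff fun l hl =>
      ⟨(hS.contDiffAt hl).differentiableAt (by norm_num), hS.pos _ hl⟩]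
    refine fun l _ => ⟨(hasDerivAt_comoving ξ l).differentiableAt, ?_, fun α => ?_⟩
    · simpa [hd] using hasDerivAt_const l (1 : ℝ)
    · simpa [hd] using hasDerivAt_const l (0 : ℝ)
  · rw [hnorm]; norm_num
  · simp [hd]
  · exact tendsto_id.mono_left nhdsWithin_le_nhds
  · rw [hnorm]; norm_num

lemma tidal_comoving (hS : IsSuddenSingularity a t₀ tS aS HS) (ξ : Fin 3 → ℝ) (i j : Fin 4)
    {t : ℝ} (ht : t ∈ Ioo t₀ tS) :
    tidal (friedmannMetric a) (comoving ξ) i j t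
      = if i = j ∧ i ≠ 0 then -(deriv (hubble a) t + hubble a t ^ 2) else 0 := by
  have h := sum_tidal_of_contDiffAt (γ := comoving ξ) (l := t) (hS.contDiffAt ht) (hS.pos t ht)
    (fun _ => Pi.single j 1) i
  simp only [Pi.single_apply, mul_ite, mul_one, mul_zero, Finset.sum_ite_eq', Finset.mem_univ,
    if_true] at h
  rw [h, (hS.hasDerivAt_hubble ht).deriv, (hasDerivAt_comoving ξ t).deriv]
  refine Fin.cases ?_ (fun α => ?_) i
  · simp
  · have : (0 : Fin 4) ≠ α.succ := (Fin.succ_ne_zero α).symm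
    by_cases hj : j = α.succ
    · subst hj
      simp [this, comoving]
    · simp [Ne.symm hj]

/-- The Hubble parameter, with its limit as value from `tS` on, is continuous up to `tS`. -/
lemma continuousOn_hubble_extended (hS : IsSuddenSingularity a t₀ tS aS HS) {τ : ℝ}
    (hτ : τ ∈ Ioo t₀ tS) : ContinuousOn (fun t => if t < tS then hubble a t else HS) (Icc τ tS) := by
  intro t ht
  rcases ht.2.lt_or_eq with h | rfl
  · refine ContinuousAt.continuousWithinAt ?_
    refine (hS.hasDerivAt_hubble ⟨hτ.1.trans_le ht.1, h⟩).continuousAt.congr ?_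
    filter_upwards [Iio_mem_nhds h] with r hr using (if_pos hr).symm
  · refine ContinuousWithinAt.mono ?_ (t := Iic t) Icc_subset_Iic_self
    rw [← continuousWithinAt_Iio_iff_Iic, ContinuousWithinAt, if_neg (lt_irrefl t)]
    refine hS.tendsto_hubble.congr' ?_
    filter_upwards [self_mem_nhdsWithin] with r hr using (if_pos hr).symm

/-- Although `Ḣ → -∞`, it is integrable up to the singularity, since the Hubble parameter is
finally decreasing and has a finite limit. -/
lemma integrableOn_deriv_hubble (hS : IsSuddenSingularity a t₀ tS aS HS) {τ : ℝ}
    (hτ : τ ∈ Ioo t₀ tS) : IntegrableOn (deriv (hubble a)) (Ioo τ tS) := by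
  obtain ⟨σ₀, hσ₀, hneg⟩ := (mem_nhdsLT_iff_exists_Ioo_subset).1
    (hS.tendsto_deriv_hubble.eventually_le_atBot 0)
  obtain ⟨σ, hσ, hσS⟩ := exists_between (max_lt hτ.2 hσ₀)
  have hτσ := (le_max_left _ _).trans_lt hσ
  have hσσ := (le_max_right _ _).trans_lt hσ
  have hσ' : σ ∈ Ioo t₀ tS := ⟨hτ.1.trans hτσ, hσS⟩
  have hcont : ContinuousOn (deriv (hubble a)) (Ioo t₀ tS) := by
    have h1 : ContDiffOn ℝ 1 (deriv a) (Ioo t₀ tS) :=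
      hS.contDiffOn.deriv_of_isOpen isOpen_Ioo (by norm_num)
    have h2 : ContDiffOn ℝ 1 (hubble a) (Ioo t₀ tS) :=
      h1.div (hS.contDiffOn.of_le (by norm_num)) fun t ht => (hS.pos t ht).ne'
    exact h2.continuousOn_deriv_of_isOpen isOpen_Ioo le_rfl
  have h1 : IntegrableOn (deriv (hubble a)) (Icc τ σ) :=
    (hcont.mono fun t ht => ⟨hτ.1.trans_le ht.1, ht.2.trans_lt hσS⟩).integrableOn_Icc
  have h2 : IntegrableOn (fun t => -deriv (hubble a) t) (Ioc σ tS) := by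
    refine intervalIntegral.integrableOn_deriv_of_nonneg (hS.continuousOn_hubble_extended hσ').neg
      (fun t ht => ?_) fun t ht => neg_nonneg.2 (hneg ⟨hσσ.trans ht.1, ht.2⟩)
    have hd := (hS.hasDerivAt_hubble ⟨hσ'.1.trans ht.1, ht.2⟩).differentiableAt.hasDerivAt
    refine hd.neg.congr_of_eventuallyEq ?_
    filter_upwards [Iio_mem_nhds ht.2] with r hr
    simp [mem_Iio.1 hr]
  have h2' : IntegrableOn (deriv (hubble a)) (Ioc σ tS) := by simpa using! h2.neg
  refine (h1.union h2').mono_set fun t ht => ?_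
  rcases le_or_gt t σ with h | h
  · exact Or.inl ⟨ht.1.le, h⟩
  · exact Or.inr ⟨h, ht.2.le⟩

lemma integrableOn_tidal_comoving (hS : IsSuddenSingularity a t₀ tS aS HS) (ξ : Fin 3 → ℝ)
    (i j : Fin 4) {τ : ℝ} (hτ : τ ∈ Ioo t₀ tS) :
    IntegrableOn (tidal (friedmannMetric a) (comoving ξ) i j) (Ioo τ tS) := by
  have h : IntegrableOn (fun t => if i = j ∧ i ≠ 0 then
      -(deriv (hubble a) t + (if t < tS then hubble a t else HS) ^ 2) else 0) (Ioo τ tS) := by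
    split_ifs
    · exact ((hS.integrableOn_deriv_hubble hτ).add
        (((hS.continuousOn_hubble_extended hτ).pow 2).integrableOn_Icc.mono_set
          Ioo_subset_Icc_self)).neg
    · exact integrableOn_zero
  refine h.congr_fun (fun t ht => ?_) measurableSet_Ioo
  rw [hS.tidal_comoving ξ i j ⟨hτ.1.trans ht.1, ht.2⟩]
  simp [ht.2]

end IsSuddenSingularity

lemma ContinuousOn.tendsto_left_endpoint {F : ℝ → ℝ} {τ T : ℝ} (hF : ContinuousOn F (Icc τ T))
    (hlt : τ < T) : Tendsto F (𝓝[<] T) (𝓝 (F T)) := by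
  have h := hF T (right_mem_Icc.2 hlt.le)
  rw [continuousWithinAt_Icc_iff_Iic hlt, ← continuousWithinAt_Iio_iff_Iic] at h
  exact h

lemma integral_converges_of_integrableOn {f : ℝ → ℝ} {τ T : ℝ} (hlt : τ < T)
    (hf : IntegrableOn f (Ioo τ T)) :
    (∃ L, Tendsto (fun l => ∫ r in τ..l, |f r|) (𝓝[<] T) (𝓝 L)) ∧
    IntegrableOn (fun l => ∫ r in τ..l, |f r|) (Ioo τ T) ∧
    ∃ L, Tendsto (fun l => ∫ l' in τ..l, ∫ r in τ..l', |f r|) (𝓝[<] T) (𝓝 L) := by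
  have hprim : ∀ {f : ℝ → ℝ}, IntegrableOn f (Icc τ T) →
      ContinuousOn (fun l => ∫ r in τ..l, f r) (Icc τ T) := fun {f} hf => by
    have := intervalIntegral.continuousOn_primitive_interval (a := τ) (b := T) (f := f)
      (μ := volume)
    rw [uIcc_of_le hlt.le] at this
    exact this hf
  have hf' : IntegrableOn f (Icc τ T) :=
    (integrableOn_Icc_iff_integrableOn_Ioo (by simp) (by simp)).2 hf
  have h1 := hprim hf'.abs
  have h2 := hprim h1.integrableOn_Icc
  exact ⟨⟨_, h1.tendsto_left_endpoint hlt⟩, h1.integrableOn_Icc.mono_set Ioo_subset_Icc_self,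
    ⟨_, h2.tendsto_left_endpoint hlt⟩⟩

/-! ### Continuation of the scale factor -/

lemma contDiffOn_one_of_hasDerivAt {E : Type*} [NormedAddCommGroup E] [NormedSpace ℝ E]
    {f f' : ℝ → E} {s : Set ℝ} (hs : IsOpen s) (hd : ∀ x ∈ s, HasDerivAt f (f' x) x)
    (hc : ContinuousOn f' s) : ContDiffOn ℝ 1 f s := by
  rw [show (1 : WithTop ℕ∞) = 0 + 1 by simp, contDiffOn_succ_iff_deriv_of_isOpen hs,
    contDiffOn_zero]
  exact ⟨fun x hx => (hd x hx).differentiableAt.differentiableWithinAt, by simp,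
    hc.congr fun x hx => (hd x hx).deriv⟩

/-- Beyond the singularity the scale factor is continued by its tangent line. -/
theorem IsSuddenSingularity.exists_continuation {a : ℝ → ℝ} {t₀ tS aS HS : ℝ}
    (hS : IsSuddenSingularity a t₀ tS aS HS) :
    ∃ (t₁ : ℝ) (b : ℝ → ℝ), IsContinuation a b t₀ tS t₁ ∧
      ContDiffOn ℝ 1 b (Ioo t₀ t₁) ∧ ContDiffOn ℝ 2 b (Ioo tS t₁) := by
  set L : ℝ → ℝ := fun t => aS + HS * aS * (t - tS)
  have hLd : ∀ t, HasDerivAt L (HS * aS) t := fun t =>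
    (((hasDerivAt_id t).sub_const tS).const_mul (HS * aS)).const_add aS |>.congr_deriv (mul_one _)
  have hLS : L tS = aS := by simp [L]
  have hLpos : ∀ᶠ t in 𝓝[>] tS, 0 < L t :=
    ((hLd tS).continuousAt.eventually_const_lt (hLS ▸ hS.aS_pos)).filter_mono nhdsWithin_le_nhds
  obtain ⟨t₁, ht₁, hpos⟩ := (mem_nhdsGT_iff_exists_Ioo_subset).1 hLpos
  set b : ℝ → ℝ := fun t => if t < tS then a t else L t
  set b' : ℝ → ℝ := fun t => if t < tS then deriv a t else HS * aS
  have hlt : ∀ {t}, t < tS → b =ᶠ[𝓝 t] a := fun h => by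
    filter_upwards [Iio_mem_nhds h] with r hr using if_pos hr
  have hgt : ∀ {t}, tS < t → b =ᶠ[𝓝 t] L := fun h => by
    filter_upwards [Ioi_mem_nhds h] with r hr using if_neg (not_lt.2 (le_of_lt hr))
  have hbS : b tS = aS := (if_neg (lt_irrefl tS)).trans hLS
  have hleft : ∀ᶠ t in 𝓝[<] tS, a t = b t ∧ deriv a t = b' t ∧ deriv a t = deriv b t := by
    filter_upwards [self_mem_nhdsWithin] with r hr
    exact ⟨(if_pos hr).symm, (if_pos hr).symm, (hlt hr).deriv_eq.symm⟩
  have hd : ∀ t ∈ Ioo t₀ t₁, HasDerivAt b (b' t) t := by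
    intro t ht
    rcases lt_trichotomy t tS with h | rfl | h
    · simp only [b', if_pos h]
      exact ((hS.contDiffAt ⟨ht.1, h⟩).differentiableAt
        (by norm_num)).hasDerivAt.congr_of_eventuallyEq (hlt h)
    · simp only [b', lt_irrefl, if_false]
      rw [← hasDerivWithinAt_univ, ← Iic_union_Ici]
      refine HasDerivWithinAt.union ?_ ?_
      · refine hasDerivWithinAt_Iic_of_tendsto_deriv (s := Ioo t₀ t) (fun r hr => ?_) ?_
          (Ioo_mem_nhdsLT hS.lt) (hS.tendsto_deriv.congr' (hleft.mono fun r hr => hr.2.2))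
        · exact ((hlt hr.2).differentiableAt_iff.2 ((hS.contDiffAt hr).differentiableAt
            (by norm_num))).differentiableWithinAt
        · refine ContinuousWithinAt.mono (t := Iio t) ?_ fun r hr => hr.2
          rw [ContinuousWithinAt, hbS]
          exact hS.tendsto_scale.congr' (hleft.mono fun r hr => hr.1)
      · exact (hLd t).hasDerivWithinAt.congr (fun r hr => if_neg (not_lt.2 hr))
          (if_neg (lt_irrefl t))
    · simp only [b', if_neg h.not_gt]
      exact (hLd t).congr_of_eventuallyEq (hgt h)
  have hc : ContinuousOn b' (Ioo t₀ t₁) := by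
    intro t ht
    refine ContinuousAt.continuousWithinAt ?_
    rcases lt_trichotomy t tS with h | rfl | h
    · refine (hS.contDiffAt ⟨ht.1, h⟩).hasDerivAt_deriv_of_two.2.continuousAt.congr ?_
      filter_upwards [Iio_mem_nhds h] with r hr using (if_pos hr).symm
    · have hb' : b' t = HS * aS := if_neg (lt_irrefl t)
      refine continuousAt_iff_continuous_left'_right'.2 ⟨?_, ?_⟩ <;> rw [ContinuousWithinAt, hb']
      · exact hS.tendsto_deriv.congr' (hleft.mono fun r hr => hr.2.1)
      · refine tendsto_const_nhds.congr' ?_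
        filter_upwards [self_mem_nhdsWithin] with r hr
        exact (if_neg (not_lt.2 (le_of_lt hr))).symm
    · refine (continuousAt_const (y := HS * aS)).congr ?_
      filter_upwards [Ioi_mem_nhds h] with r hr using (if_neg (not_lt.2 (le_of_lt hr))).symm
  refine ⟨t₁, b, ⟨ht₁, fun t ht => if_pos ht.2, fun t ht => ?_,
    fun t ht => (hd t ht).continuousAt.continuousWithinAt⟩,
    contDiffOn_one_of_hasDerivAt isOpen_Ioo hd hc, ?_⟩
  · rcases lt_trichotomy t tS with h | rfl | h
    · exact (hS.pos t ⟨ht.1, h⟩).trans_eq (if_pos h).symm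
    · rw [hbS]; exact hS.aS_pos
    · exact (hpos ⟨h, ht.2⟩ : 0 < L t).trans_eq (if_neg h.not_gt).symm
  · have hL : ContDiff ℝ 2 L := by fun_prop
    exact hL.contDiffOn.congr fun t ht => if_neg ht.1.not_gt

/-! ### Continuation of geodesics -/

/-- The inverse function theorem on the line for a right inverse `T` of a strictly increasing
function, which is automatically continuous. -/
lemma hasDerivAt_of_rightInverse {Λ Λ' T : ℝ → ℝ} {J I : Set ℝ} (hJ : IsOpen J) (hI : IsOpen I)
    (hd : ∀ t ∈ J, HasDerivAt Λ (Λ' t) t) (hpos : ∀ t ∈ J, 0 < Λ' t) (hmono : StrictMonoOn Λ J)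
    (hT : ∀ l ∈ I, T l ∈ J ∧ Λ (T l) = l) {l : ℝ} (hl : l ∈ I) :
    HasDerivAt T (Λ' (T l))⁻¹ l := by
  have hTmono : StrictMonoOn T I := fun x hx y hy hxy => by
    rwa [← hmono.lt_iff_lt (hT x hx).1 (hT y hy).1, (hT x hx).2, (hT y hy).2]
  have himage : T '' I ∈ 𝓝 (T l) := by
    have h1 : Λ ⁻¹' I ∈ 𝓝 (T l) := (hd _ (hT l hl).1).continuousAt.preimage_mem_nhds
      (by rw [(hT l hl).2]; exact hI.mem_nhds hl)
    filter_upwards [h1, hJ.mem_nhds (hT l hl).1] with t ht htJ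
    exact ⟨Λ t, ht, hmono.injOn (hT _ ht).1 htJ (hT _ ht).2⟩
  refine HasDerivAt.of_local_left_inverse
    (hTmono.continuousAt_of_image_mem_nhds (hI.mem_nhds hl) himage)
    (hd _ (hT l hl).1) (hpos _ (hT l hl).1).ne' ?_
  filter_upwards [hI.mem_nhds hl] with r hr using (hT r hr).2

/-- Solutions of the integrated geodesic equations satisfy the geodesic equation if the scale
factor is differentiable. -/
lemma isGeodesicOn_of_integrated {b : ℝ → ℝ} {c : ℝ → Pt} {s : Set ℝ} (hs : IsOpen s) {ε : ℝ}
    {P : Fin 3 → ℝ} (hb : ∀ l ∈ s, DifferentiableAt ℝ b (c l 0) ∧ 0 < b (c l 0))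
    (hpos : ∀ l ∈ s, 0 < deriv c l 0) (h : SatisfiesIntegratedGeodesicEq b c ε P s) :
    IsGeodesicOn (friedmannMetric b) c s := by
  rw [isGeodesicOn_friedmannMetric_iff hb]
  intro l hl
  obtain ⟨hc, h1, h2⟩ := h l hl
  have h0 := (hb l hl).2.ne'
  have hu := (hpos l hl).ne'
  have hB : HasDerivAt (fun l => b (c l 0)) (deriv b (c l 0) * deriv c l 0) l :=
    (hb l hl).1.hasDerivAt.comp l (hasDerivAt_pi.1 hc.hasDerivAt 0)
  refine ⟨hc, ?_, fun α => ?_⟩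
  · have hev : (fun l => deriv c l 0) =ᶠ[𝓝 l]
        fun l => √(ε + (∑ α, P α ^ 2) / b (c l 0) ^ 2) := by
      filter_upwards [hs.mem_nhds hl] with m hm
      rw [← (h m hm).2.2, Real.sqrt_sq (hpos m hm).le]
    have hE : HasDerivAt (fun l => ε + (∑ α, P α ^ 2) / b (c l 0) ^ 2) _ l :=
      ((hasDerivAt_const l (∑ α, P α ^ 2)).fun_div (hB.fun_pow 2)
        (pow_ne_zero 2 h0)).const_add ε
    refine ((hE.sqrt ?_).congr_of_eventuallyEq hev).congr_deriv ?_
    · rw [← h2]; exact pow_ne_zero 2 hu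
    · rw [← h2, Real.sqrt_sq (hpos l hl).le]
      have : ∑ α : Fin 3, deriv c l α.succ * deriv c l α.succ
          = (∑ α, P α ^ 2) / b (c l 0) ^ 4 := by
        rw [Finset.sum_div]
        refine Finset.sum_congr rfl fun α _ => ?_
        rw [h1]
        field_simp
      rw [this]
      simp
      field_simp
  · have hev : (fun l => deriv c l α.succ) =ᶠ[𝓝 l] fun l => P α / b (c l 0) ^ 2 := by
      filter_upwards [hs.mem_nhds hl] with m hm using (h m hm).2.1 α
    refine (((hasDerivAt_const l (P α)).fun_div (hB.fun_pow 2)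
        (pow_ne_zero 2 h0)).congr_of_eventuallyEq hev).congr_deriv ?_
    rw [h1]
    simp
    field_simp

/-- Along a causal geodesic the affine parameter is the primitive of `1 / (dt/dl)`, where `dt/dl`
is a continuous positive function of `t` as long as the scale factor is continuous and positive.
The inverse of this primitive continues the geodesic. -/
theorem IsSuddenSingularity.exists_geodesic_continuation {a b : ℝ → ℝ} {t₀ tS t₁ aS HS : ℝ}
    (hS : IsSuddenSingularity a t₀ tS aS HS) (hb : IsContinuation a b t₀ tS t₁) {γ : ℝ → Pt}
    {l₀ lS : ℝ} (hγ : IsCausalGeodesicInto a t₀ tS γ l₀ lS) :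
    ∃ (l₁ : ℝ) (c : ℝ → Pt) (ε : ℝ) (P : Fin 3 → ℝ), lS < l₁ ∧
      EqOn c γ (Ioo l₀ lS) ∧ ContDiffOn ℝ 1 c (Ioo l₀ l₁) ∧ c lS 0 = tS ∧
      (∀ l ∈ Ioo l₀ l₁, c l 0 ∈ Ioo t₀ t₁ ∧ 0 < deriv c l 0) ∧
      SatisfiesIntegratedGeodesicEq b c ε P (Ioo l₀ l₁) ∧
      (DifferentiableOn ℝ b (Ioo t₀ t₁) → IsGeodesicOn (friedmannMetric b) c (Ioo l₀ l₁)) := by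
  obtain ⟨ε, P, -, hpos, hP⟩ := hγ.exists_momentum fun l hl =>
    ⟨(hS.contDiffAt (hγ.mem l hl)).differentiableAt (by norm_num), hS.pos _ (hγ.mem l hl)⟩
  have hγd : ∀ l ∈ Ioo l₀ lS, ∀ μ, HasDerivAt (fun l => γ l μ) (deriv γ l μ) l := fun l hl =>
    hasDerivAt_pi.1 (hγ.geodesic l hl).1.hasDerivAt
  have htS : tS ∈ Ioo t₀ t₁ := ⟨hS.lt, hb.lt⟩
  have hsub : ∀ l ∈ Ioo l₀ lS, γ l 0 ∈ Ioo t₀ t₁ := fun l hl =>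
    ⟨(hγ.mem l hl).1, (hγ.mem l hl).2.trans hb.lt⟩
  -- the velocity `dt/dl` as a function of `t`
  set φ : ℝ → ℝ := fun t => √(ε + (∑ α, P α ^ 2) / b t ^ 2)
  have hφpos : ∀ t ∈ Ioo t₀ t₁, 0 < φ t := fun t ht => Real.sqrt_pos.2 (hpos _ (hb.pos t ht))
  have hφc : ContinuousOn φ (Ioo t₀ t₁) :=
    (continuousOn_const.add (continuousOn_const.div (hb.continuousOn.pow 2)
      fun t ht => pow_ne_zero 2 (hb.pos t ht).ne')).sqrt
  have hφγ : ∀ l ∈ Ioo l₀ lS, φ (γ l 0) = deriv γ l 0 := fun l hl => by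
    simp only [φ]
    rw [hb.eqOn (hγ.mem l hl), ← (hP l hl).2.1, Real.sqrt_sq (hγ.future l hl).le]
  -- the affine parameter as a function of `t`
  set Λ : ℝ → ℝ := fun t => lS + ∫ r in tS..t, (φ r)⁻¹
  have hΛd : ∀ t ∈ Ioo t₀ t₁, HasDerivAt Λ (φ t)⁻¹ t := fun t ht =>
    (hasDerivAt_integral_of_continuousOn isOpen_Ioo ordConnected_Ioo
      (hφc.inv₀ fun r hr => (hφpos r hr).ne') htS ht).const_add lS
  have hΛpos : ∀ t ∈ Ioo t₀ t₁, 0 < (φ t)⁻¹ := fun t ht => inv_pos.2 (hφpos t ht)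
  have hΛc : ContinuousOn Λ (Ioo t₀ t₁) := fun t ht =>
    (hΛd t ht).continuousAt.continuousWithinAt
  have hΛmono : StrictMonoOn Λ (Ioo t₀ t₁) := by
    refine strictMonoOn_of_deriv_pos (convex_Ioo _ _) hΛc fun t ht => ?_
    rw [interior_Ioo] at ht
    rw [(hΛd t ht).deriv]
    exact hΛpos t ht
  have hΛS : Λ tS = lS := by simp [Λ]
  have hΛγ : ∀ l ∈ Ioo l₀ lS, Λ (γ l 0) = l := by
    have hd : ∀ l ∈ Ioo l₀ lS, HasDerivAt (fun l => Λ (γ l 0) - l) 0 l := fun l hl => by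
      refine (((hΛd _ (hsub l hl)).comp l (hγd l hl 0)).sub (hasDerivAt_id l)).congr_deriv ?_
      rw [hφγ l hl, inv_mul_cancel₀ (hγ.future l hl).ne', sub_self]
    obtain ⟨k, hk⟩ := isOpen_Ioo.exists_is_const_of_deriv_eq_zero isPreconnected_Ioo
      (fun l hl => (hd l hl).differentiableAt.differentiableWithinAt) fun l hl => (hd l hl).deriv
    have h1 : Tendsto (fun l => Λ (γ l 0) - l) (𝓝[<] lS) (𝓝 (Λ tS - lS)) :=
      ((hΛd tS htS).continuousAt.tendsto.comp hγ.tendsto).sub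
        (tendsto_id.mono_left nhdsWithin_le_nhds)
    have h2 : Tendsto (fun l => Λ (γ l 0) - l) (𝓝[<] lS) (𝓝 k) := by
      refine tendsto_const_nhds.congr' ?_
      filter_upwards [Ioo_mem_nhdsLT hγ.lt] with l hl using (hk l hl).symm
    have h3 := tendsto_nhds_unique h1 h2
    intro l hl
    have := hk l hl
    rw [← h3, hΛS, sub_self] at this
    exact sub_eq_zero.1 this
  obtain ⟨t₂, hS2, h21⟩ := exists_between hb.lt
  have ht₂ : t₂ ∈ Ioo t₀ t₁ := ⟨hS.lt.trans hS2, h21⟩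
  have hl₁ : lS < Λ t₂ := hΛS ▸ hΛmono htS ht₂ hS2
  have hsurj : ∀ l ∈ Ioo l₀ (Λ t₂), ∃ t, t ∈ Ioo t₀ t₁ ∧ Λ t = l := by
    intro l hl
    rcases lt_or_ge l lS with h | h
    · exact ⟨γ l 0, hsub l ⟨hl.1, h⟩, hΛγ l ⟨hl.1, h⟩⟩
    · have hIcc : Icc tS t₂ ⊆ Ioo t₀ t₁ := fun t ht => ⟨hS.lt.trans_le ht.1, ht.2.trans_lt h21⟩
      obtain ⟨t, ht, htl⟩ := intermediate_value_Icc hS2.le (hΛc.mono hIcc)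
        ⟨hΛS.trans_le h, hl.2.le⟩
      exact ⟨t, hIcc ht, htl⟩
  choose! T hT using hsurj
  have hTd : ∀ l ∈ Ioo l₀ (Λ t₂), HasDerivAt T (φ (T l)) l := fun l hl => by
    simpa using hasDerivAt_of_rightInverse isOpen_Ioo isOpen_Ioo hΛd hΛpos hΛmono hT hl
  have hTc : ContinuousOn T (Ioo l₀ (Λ t₂)) := fun l hl =>
    (hTd l hl).continuousAt.continuousWithinAt
  have hTmaps : MapsTo T (Ioo l₀ (Λ t₂)) (Ioo t₀ t₁) := fun l hl => (hT l hl).1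
  have hTγ : ∀ l ∈ Ioo l₀ lS, T l = γ l 0 := fun l hl =>
    hΛmono.injOn (hT l ⟨hl.1, hl.2.trans hl₁⟩).1 (hsub l hl)
      ((hT l ⟨hl.1, hl.2.trans hl₁⟩).2.trans (hΛγ l hl).symm)
  have hTS : T lS = tS := hΛmono.injOn (hT lS ⟨hγ.lt, hl₁⟩).1 htS
    ((hT lS ⟨hγ.lt, hl₁⟩).2.trans hΛS.symm)
  have hψc : ∀ α, ContinuousOn (fun l => P α / b (T l) ^ 2) (Ioo l₀ (Λ t₂)) := fun α =>
    continuousOn_const.div ((hb.continuousOn.comp hTc hTmaps).pow 2)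
      fun l hl => pow_ne_zero 2 (hb.pos _ (hTmaps hl)).ne'
  obtain ⟨q, hq⟩ := exists_between hγ.lt
  have hXd : ∀ α, ∀ l ∈ Ioo l₀ (Λ t₂), HasDerivAt
      (fun l => γ q (Fin.succ α) + ∫ r in q..l, P α / b (T r) ^ 2) (P α / b (T l) ^ 2) l :=
    fun α l hl => (hasDerivAt_integral_of_continuousOn isOpen_Ioo ordConnected_Ioo (hψc α)
      ⟨hq.1, hq.2.trans hl₁⟩ hl).const_add _
  set c : ℝ → Pt := fun l => Fin.cons (T l) fun α =>
    γ q (Fin.succ α) + ∫ r in q..l, P α / b (T r) ^ 2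
  have hcd : ∀ l ∈ Ioo l₀ (Λ t₂), HasDerivAt c
      (Fin.cons (φ (T l)) fun α => P α / b (T l) ^ 2 : Pt) l := fun l hl =>
    hasDerivAt_cons (hTd l hl) fun α => hXd α l hl
  have hint : SatisfiesIntegratedGeodesicEq b c ε P (Ioo l₀ (Λ t₂)) := fun l hl => by
    refine ⟨(hcd l hl).differentiableAt, fun α => ?_, ?_⟩ <;> rw [(hcd l hl).deriv]
    · rfl
    · exact Real.sq_sqrt (hpos _ (hb.pos _ (hTmaps hl))).le
  have hfut : ∀ l ∈ Ioo l₀ (Λ t₂), 0 < deriv c l 0 := fun l hl => by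
    rw [(hcd l hl).deriv]
    exact hφpos _ (hTmaps hl)
  refine ⟨Λ t₂, c, ε, P, hl₁, fun l hl => ?_, ?_, hTS, fun l hl => ⟨hTmaps hl, hfut l hl⟩, hint,
    fun hdiff => ?_⟩
  · funext μ
    refine Fin.cases (hTγ l hl) (fun α => ?_) μ
    have hsub' : ∀ l ∈ Ioo l₀ lS, l ∈ Ioo l₀ (Λ t₂) := fun l hl => ⟨hl.1, hl.2.trans hl₁⟩
    refine isOpen_Ioo.eqOn_of_deriv_eq isPreconnected_Ioo
      (f := fun l => c l α.succ) (g := fun l => γ l α.succ)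
      (fun l hl => (hXd α l (hsub' l hl)).differentiableAt.differentiableWithinAt)
      (fun l hl => (hγd l hl α.succ).differentiableAt.differentiableWithinAt)
      (fun l hl => ?_) hq ?_ hl
    · rw [(hγd l hl α.succ).deriv, (hP l hl).1, ← hb.eqOn (hγ.mem l hl), ← hTγ l hl]
      exact (hXd α l (hsub' l hl)).deriv
    · simp [c]
  · refine contDiffOn_one_of_hasDerivAt isOpen_Ioo hcd (continuousOn_pi.2 fun μ => ?_)
    exact Fin.cases (hφc.comp hTc hTmaps) (fun α => hψc α) μ
  · exact isGeodesicOn_of_integrated isOpen_Ioo (fun l hl =>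
      ⟨hdiff.differentiableAt (isOpen_Ioo.mem_nhds (hTmaps hl)), hb.pos _ (hTmaps hl)⟩) hfut hint

theorem mainTheorem6 (a : ℝ → ℝ) (t₀ tS aS HS : ℝ)
    (hS : IsSuddenSingularity a t₀ tS aS HS) :
    -- the comoving curves are timelike geodesics running into the singularity, affine parameter t
    (∀ ξ : Fin 3 → ℝ, IsCausalGeodesicInto a t₀ tS (comoving ξ) t₀ tS ∧
      IsTimelikeOn (friedmannMetric a) (comoving ξ) (Ioo t₀ tS)) ∧
    -- the single and the double curvature integrals along them converge
    (∀ (ξ : Fin 3 → ℝ) (i j : Fin 4), ∀ τ ∈ Ioo t₀ tS,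
      IntegrableOn (tidal (friedmannMetric a) (comoving ξ) i j) (Ioo τ tS) ∧
      (∃ L : ℝ, Tendsto (krolakIntegral (friedmannMetric a) (comoving ξ) i j τ)
        (𝓝[<] tS) (𝓝 L)) ∧
      IntegrableOn (krolakIntegral (friedmannMetric a) (comoving ξ) i j τ) (Ioo τ tS) ∧
      (∃ L : ℝ, Tendsto (tiplerIntegral (friedmannMetric a) (comoving ξ) i j τ)
        (𝓝[<] tS) (𝓝 L))) ∧
    -- no causal geodesic running into the singularity meets a strong one, in either sense
    (∀ (γ : ℝ → Pt) (l₀ lS : ℝ), IsCausalGeodesicInto a t₀ tS γ l₀ lS →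
      ¬ TiplerStrong (friedmannMetric a) γ l₀ lS ∧
      ¬ KrolakStrong (friedmannMetric a) γ l₀ lS) ∧
    -- the scale factor has a continuously differentiable continuation beyond the singularity
    (∃ (t₁ : ℝ) (b : ℝ → ℝ), IsContinuation a b t₀ tS t₁ ∧
      ContDiffOn ℝ 1 b (Ioo t₀ t₁) ∧ ContDiffOn ℝ 2 b (Ioo tS t₁)) ∧
    -- whatever the continuation, all causal geodesics are continued through the singularity
    (∀ (t₁ : ℝ) (b : ℝ → ℝ), IsContinuation a b t₀ tS t₁ →
      ∀ (γ : ℝ → Pt) (l₀ lS : ℝ), IsCausalGeodesicInto a t₀ tS γ l₀ lS →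
        ∃ (l₁ : ℝ) (c : ℝ → Pt) (ε : ℝ) (P : Fin 3 → ℝ), lS < l₁ ∧
          EqOn c γ (Ioo l₀ lS) ∧ ContDiffOn ℝ 1 c (Ioo l₀ l₁) ∧ c lS 0 = tS ∧
          (∀ l ∈ Ioo l₀ l₁, c l 0 ∈ Ioo t₀ t₁ ∧ 0 < deriv c l 0) ∧
          SatisfiesIntegratedGeodesicEq b c ε P (Ioo l₀ l₁) ∧
          (DifferentiableOn ℝ b (Ioo t₀ t₁) →
            IsGeodesicOn (friedmannMetric b) c (Ioo l₀ l₁))) := by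
  refine ⟨hS.comoving_isCausalGeodesicInto, fun ξ i j τ hτ => ?_,
    fun _ _ _ hγ => hS.not_strong hγ, hS.exists_continuation,
    fun _ _ hb _ _ _ hγ => hS.exists_geodesic_continuation hb hγ⟩
  have hint := hS.integrableOn_tidal_comoving ξ i j hτ
  exact ⟨hint, integral_converges_of_integrableOn hτ.2 hint⟩
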